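/- **Setting.** A Bayesian network has a finite set $V$ of variables with finite non-empty domains $D_v$, an acyclic parent relation $\mathrm{Pa}_v\subseteq V$, and for each $v$ a conditional probability distribution $P_v=P(v\mid \mathrm{Pa}_v)$, a non-negative function of $C_v:=\{v\}\cup\mathrm{Pa}_v$ with $\sum_{a\in D_v}P_v=1$. A *clique tree forest* (CTF) is a finite graph whose nodes are sets of variables ("cliques"), together with finitely many real factors, each assigned to one node. The sepset of an edge $A\!-\!B$ is $A\cap B$. A CTF is *valid* for a function $Q$ if: (i) the graph has no loops; (ii) cliques are non-empty and maximal (none is contained in another one); (iii) the running intersection property holds: two cliques sharing a variable $x$ are connected, and $x$ lies in every clique on the path between them; (iv) the scope of every assigned factor is contained in its clique, and the product of all assigned factors is $Q$. For a forest and a set $P$ of variables, $\mathrm{MSG}[P]$ denotes a subgraph obtained from the subgraph that connects (within each tree) all cliques meeting $P$ by repeatedly removing a leaf $A$ with neighbour $B$ such that $A\cap P\subseteq B\cap P$, until none is left. **Algorithm BuildCTF.** Input: a CTF, a set $G\subseteq V$ of variables still to be added, evidence variables $E$, and a clique size bound $mcs$; the size of a clique $C$ is $\log_2\prod_{v\in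 C}|D_v|$. If the CTF is empty, start with the isolated cliques $\{v\}$, with factor $P_v$, for the variables $v\in G$ that have no parent in $G$, and delete these from $G$ and $E$. The active variables are those in $G$ with no parent in $G$. While there are active variables, take out the set $N$ of those of minimal topological level and call ModifyCTF on it; delete the set $N_a\subseteq N$ of added variables from $G$ and $E$, put the parents of $N\setminus N_a$ into the set $IV$ of interface variables, and make the children of $N_a$ that now have no parent in $G$ active. Output: the CTF, $IV$, and the remaining sets $G'$, $E'$. **ModifyCTF.** First, for each $v\in N$ in any order, let $U=\mathrm{MSG}[\mathrm{Pa}_v]$. If $U$ has a single node (Case 1) or no edges (Case 2), connect $C_v$ to every clique of $U$; a clique of $U$ contained in $C_v$ is removed, and its neighbours and factors go to $C_v$; assign $P_v$ to $C_v$. The other variables (Case 3) are split into groups with overlapping $\mathrm{MSG}[\mathrm{Pa}_v]$. For each group $g$ on the list, in any order, let $U$ be the minimal subgraph of the current CTF that connects, within each tree, the subgraphs $\mathrm{MSG}[\mathrm{Pa}_v]$, $v\in g$. Then: 1. $S$ is the set of the parents of the $v\in g$ and of all variables in sepsets of $U$. 2. The retained cliques are the cliques of $U$ not contained in $S$. 3.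 The elimination graph on $S$ has the edges making each $C\cap S$ ($C\in U$) and each $\mathrm{Pa}_v$ ($v\in g$) complete. Take any chordal supergraph on $S$ and any clique tree $ST'$ of it (one for each connected component). In any order, connect each $C_v$, $v\in g$, to a clique $C'$ of $ST'$ containing $\mathrm{Pa}_v$, and then each retained clique $C$ to a clique $C'$ of $ST'$ containing $C\cap S$; in each case, if $C'$ is contained in the clique being attached, it is replaced by that clique. 4. If all cliques of $ST'$ have size at most $mcs$, replace $U$ by $ST'$: each edge from $A\notin U$ to $B\in U$ becomes an edge from $A$ to some clique of $ST'$ containing $A\cap B$; the factors of cliques of $U$ that are not retained are re-assigned to cliques of $ST'$ containing their scope; $P_v$ is assigned to $C_v$ for $v\in g$. The variables of $g$ are added. 5. Otherwise choose a proper subset of $g$, giving priority to variables in $E$, split it into groups with overlapping subgraphs, and put these on the list. **Theorem.** Let the input CTF be empty (then put $Q=1$) or, more generally, valid for a function $Q$. Let $W$ be the set of its variables, let $G\cap W=\varnothing$, and let all parents of variables in $G$ be in $W\cup G$. Then BuildCTF can be carried out to the end, and whatever choices are made, if it returns a CTF and the remaining set $G'$, then $G'\subseteq G$, the set of variables of the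 returned CTF is $W\cup(G\setminus G')$, and the returned CTF is a valid CTF: its graph has no loops, every clique is maximal, the running intersection property holds, every assigned factor has its scope in its clique, and the product of the assigned factors is the correct joint distribution $$\sum_{\text{states of }G'} Q\prod_{v\in G}P_v .$$ In particular, for an empty input CTF and $G=V$ this is the marginal of the joint distribution of the network on the variables of the returned CTF. -/

import Mathlib

/-! Bayesian networks -/

/-- A factor over the random variables `V` with domains `D`: a real function of a joint
assignment which depends only on the variables in its scope. -/
structure Factor (V : Type*) (D : V → Type*) where
  scope : Finset V
  val : ((v : V) → D v) → ℝ
  dependsOn : DependsOn val (scope : Set V)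

/-- A Bayesian network: a directed acyclic graph, given by the parent sets, with a conditional
probability distribution `cpd v` of every variable `v` given its parents. -/
structure BayesNet (V : Type*) (D : V → Type*) [DecidableEq V] [∀ v, Fintype (D v)] where
  parents : V → Finset V
  acyclic : ∀ v, ¬ Relation.TransGen (fun u w => u ∈ parents w) v v
  cpd : V → ((v : V) → D v) → ℝ
  cpd_nonneg : ∀ v x, 0 ≤ cpd v x
  cpd_dependsOn : ∀ v, DependsOn (cpd v) ((insert v (parents v) : Finset V) : Set V)
  cpd_sum : ∀ v x, ∑ a : D v, cpd v (Function.update x v a) = 1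

namespace BayesNet

section
variable {V : Type*} {D : V → Type*} [DecidableEq V] [∀ v, Fintype (D v)]

/-- The clique `C_v` formed by a variable and its parents. -/
def family (net : BayesNet V D) (v : V) : Finset V := insert v (net.parents v)

/-- The conditional probability distribution of `v` as a factor. -/
def cpdFactor (net : BayesNet V D) (v : V) : Factor V D where
  scope := net.family v
  val := net.cpd v
  dependsOn := net.cpd_dependsOn v

theorem wellFounded_parents [Finite V] (net : BayesNet V D) :
    WellFounded (fun u w => u ∈ net.parents w) := by
  have : Std.Irrefl (Relation.TransGen (fun u w => u ∈ net.parents w)) := ⟨net.acyclic⟩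
  have h : WellFounded (Relation.TransGen (fun u w => u ∈ net.parents w)) :=
    Finite.wellFounded_of_trans_of_irrefl _
  exact Subrelation.wf (fun h => Relation.TransGen.single h) h

/-- The topological level: `0` for a variable without parents, and otherwise one more than the
largest level of a parent. -/
noncomputable def level [Finite V] (net : BayesNet V D) : V → ℕ :=
  net.wellFounded_parents.fix fun v ih =>
    (net.parents v).attach.sup fun u => ih u.1 u.2 + 1

/-- All the factors: the factors `ψ` that come with the initial clique tree forest, and the
conditional probability distributions of the network. -/
def factor {J : Type*} (net : BayesNet V D) (ψ : J → Factor V D) : J ⊕ V → Factor V D :=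
  Sum.elim ψ net.cpdFactor

end
end BayesNet

/-- Sum the function `f` over all states of the variables in `R`. -/
noncomputable def sumOut {V : Type*} {D : V → Type*} [DecidableEq V] [∀ v, Fintype (D v)]
    (R : Finset V) (f : ((v : V) → D v) → ℝ) (x : (v : V) → D v) : ℝ :=
  ∑ y : ((v : R) → D v), f (Function.updateFinset x R y)

/-- The size of a clique: the effective number of binary variables in it. -/
noncomputable def cliqueSize {V : Type*} (D : V → Type*) [∀ v, Fintype (D v)]
    (C : Finset V) : ℝ :=
  Real.logb 2 (∏ v ∈ C, (Fintype.card (D v) : ℝ))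

/-! Graphs of cliques and clique tree forests -/

/-- A finite graph whose nodes are cliques, each labelled by its set of variables. The sepset of
an edge between `A` and `B` is `A ∩ B`. -/
structure CliqueGraph (V : Type*) where
  nodes : Finset (Finset V)
  graph : SimpleGraph (Finset V)

namespace CliqueGraph

section
variable {V : Type*} [DecidableEq V]

/-- The variables that occur in the cliques. -/
def vars (F : CliqueGraph V) : Finset V := F.nodes.biUnion id

/-- The running intersection property: two cliques that share a variable are connected, and the
variable is in every clique on the path between them. -/
def RunningIntersection (F : CliqueGraph V) : Prop :=
  ∀ (x : V), ∀ A ∈ F.nodes, ∀ B ∈ F.nodes, x ∈ A → x ∈ B →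
    F.graph.Reachable A B ∧
      ∀ p : F.graph.Walk A B, p.IsPath → ∀ C ∈ p.support, x ∈ C

/-- A disjoint union of trees on the given nodes with the running intersection property. -/
structure IsForest (F : CliqueGraph V) : Prop where
  edge_mem : ∀ A B, F.graph.Adj A B → A ∈ F.nodes ∧ B ∈ F.nodes
  acyclic : F.graph.IsAcyclic
  running : F.RunningIntersection

/-- The set `U` of nodes together with all the nodes on paths between nodes of `U`: the nodes of
the minimal subgraph of a forest that connects the nodes of `U`, as far as these lie in the same
tree. -/
noncomputable def hull (F : CliqueGraph V) (U : Finset (Finset V)) : Finset (Finset V) :=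
  open Classical in
  F.nodes.filter fun C => ∃ A ∈ U, ∃ B ∈ U, ∃ p : F.graph.Walk A B, p.IsPath ∧ C ∈ p.support

/-- `U'` is obtained from `U` by the removal of a clique `A` that has exactly one neighbour `B`
in `U`, where `A` contains the same variables of `P` as `B`, or fewer. -/
def Prune (F : CliqueGraph V) (P : Finset V) (U U' : Finset (Finset V)) : Prop :=
  ∃ A ∈ U, ∃ B ∈ U, F.graph.Adj A B ∧ (∀ C ∈ U, F.graph.Adj A C → C = B) ∧
    A ∩ P ⊆ B ∩ P ∧ U' = U.erase A

/-- `U` is the set of nodes of a minimal subgraph `MSG[P]`: start from the subgraph that connects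
all the cliques which contain variables in `P`, and prune leaves as long as possible. -/
def IsMSG (F : CliqueGraph V) (P : Finset V) (U : Finset (Finset V)) : Prop :=
  Relation.ReflTransGen (F.Prune P)
      (F.hull (F.nodes.filter fun C => (C ∩ P).Nonempty)) U ∧
    ∀ U', ¬ F.Prune P U U'

/-- No two of the cliques in `U` are adjacent. -/
def Disconnected (F : CliqueGraph V) (U : Finset (Finset V)) : Prop :=
  ∀ A ∈ U, ∀ B ∈ U, ¬ F.graph.Adj A B

/-- Connect the clique `B` to every clique in `U`; a clique in `U` that is contained in `B` is
removed, and its neighbours are connected to `B`. -/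
noncomputable def join (F : CliqueGraph V) (U : Finset (Finset V)) (B : Finset V) :
    CliqueGraph V where
  nodes := insert B (F.nodes.filter fun C => ¬ (C ∈ U ∧ C ⊆ B))
  graph := SimpleGraph.fromRel fun A C =>
    (F.graph.Adj A C ∧ ¬ (A ∈ U ∧ A ⊆ B) ∧ ¬ (C ∈ U ∧ C ⊆ B)) ∨
      (A = B ∧ ¬ (C ∈ U ∧ C ⊆ B) ∧ (C ∈ U ∨ ∃ R ∈ U, R ⊆ B ∧ F.graph.Adj R C))

/-- `F'` is obtained from `F` by attaching the cliques `B i`, `i ∈ I`, one after the other in any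
order: `B i` is connected to a clique `C` of the current graph that contains `key i`, and takes
the place of `C` if `C ⊆ B i`. -/
inductive Attach {α : Type*} [DecidableEq α] (B key : α → Finset V) :
    Finset α → CliqueGraph V → CliqueGraph V → Prop
  | done (F : CliqueGraph V) : Attach B key ∅ F F
  | step {I : Finset α} {F F' : CliqueGraph V} (i : α) (C : Finset V)
      (hi : i ∈ I) (hC : C ∈ F.nodes) (hkey : key i ⊆ C)
      (h : Attach B key (I.erase i) (F.join {C} (B i)) F') : Attach B key I F F'

end
end CliqueGraph

/-- A clique graph with factors: `factors` is the set of the factors (given by their indices)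
that have been assigned, and `host i` is the one clique to which the factor `i` is assigned
(its value at `i ∉ factors` means nothing). -/
structure CTF (V J : Type*) extends CliqueGraph V where
  factors : Finset (J ⊕ V)
  host : J ⊕ V → Finset V

/-- The clique tree forest `T` is valid for the joint distribution `Q`. -/
structure CTF.IsValid {V J : Type*} {D : V → Type*} [DecidableEq V] [∀ v, Fintype (D v)]
    (net : BayesNet V D) (ψ : J → Factor V D) (T : CTF V J)
    (Q : ((v : V) → D v) → ℝ) : Prop where
  /-- edges join nodes -/
  edge_mem : ∀ A B, T.graph.Adj A B → A ∈ T.nodes ∧ B ∈ T.nodes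
  /-- there are no loops -/
  acyclic : T.graph.IsAcyclic
  /-- cliques are non-empty sets of variables -/
  nonempty : ∀ C ∈ T.nodes, C.Nonempty
  /-- all cliques are maximal -/
  maximal : ∀ A ∈ T.nodes, ∀ B ∈ T.nodes, A ⊆ B → A = B
  /-- the running intersection property holds -/
  running : T.RunningIntersection
  /-- every factor is assigned to a clique that contains its scope -/
  assigned : ∀ i ∈ T.factors, T.host i ∈ T.nodes ∧ (net.factor ψ i).scope ⊆ T.host i
  /-- the product of the assigned factors is the joint distribution -/
  product : ∀ x, ∏ i ∈ T.factors, (net.factor ψ i).val x = Q x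

/-! Re-triangulation -/

/-- A graph is chordal if every cycle of length at least four has a chord. -/
def SimpleGraph.IsChordalGraph {V : Type*} (H : SimpleGraph V) : Prop :=
  ∀ (v : V) (c : H.Walk v v), c.IsCycle → 4 ≤ c.length →
    ∃ x ∈ c.support, ∃ y ∈ c.support, H.Adj x y ∧ s(x, y) ∉ c.edges

/-- `F` is a clique tree (one on each connected component) of the graph `H` with vertex set `S`:
its nodes are the maximal cliques, and it has the running intersection property. -/
structure CliqueGraph.IsCliqueTreeOf {V : Type*} [DecidableEq V] (F : CliqueGraph V)
    (H : SimpleGraph V) (S : Finset V) : Prop where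
  mem_nodes : ∀ K, K ∈ F.nodes ↔
    Maximal (fun L : Finset V => L.Nonempty ∧ L ⊆ S ∧ H.IsClique (L : Set V)) K
  isForest : F.IsForest

namespace BayesNet

section
variable {V : Type*} {D : V → Type*} {J : Type*}
  [Fintype V] [DecidableEq V] [DecidableEq J] [∀ v, Fintype (D v)]

/-- Step 1. The set `S` of the parents of the new variables `g` and of all the variables in
sepsets of the subgraph `U`. -/
noncomputable def elimVars (net : BayesNet V D) (F : CliqueGraph V) (g : Finset V)
    (U : Finset (Finset V)) : Finset V :=
  open Classical in
  Finset.univ.filter fun x =>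
    (∃ v ∈ g, x ∈ net.parents v) ∨ ∃ A ∈ U, ∃ B ∈ U, F.graph.Adj A B ∧ x ∈ A ∩ B

/-- Step 2. The retained cliques: the cliques in `U` that contain a variable outside `S`. -/
noncomputable def retained (net : BayesNet V D) (F : CliqueGraph V) (g : Finset V)
    (U : Finset (Finset V)) : Finset (Finset V) :=
  U.filter fun C => ¬ C ⊆ net.elimVars F g U

/-- Step 3.1. The elimination graph on `S`: the set `C ∩ S` is made complete for each clique `C`
in `U`, and moralizing edges are added between the parents of each new variable. -/
def elimGraph (net : BayesNet V D) (F : CliqueGraph V) (g : Finset V)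
    (U : Finset (Finset V)) : SimpleGraph V :=
  SimpleGraph.fromRel fun x y =>
    (∃ C ∈ U, x ∈ C ∩ net.elimVars F g U ∧ y ∈ C ∩ net.elimVars F g U) ∨
      ∃ v ∈ g, x ∈ net.parents v ∧ y ∈ net.parents v

/-- Steps 3.2 to 3.4. `ST` is obtained as follows: triangulate the elimination graph by adding
edges, take a clique tree of the result, attach the new cliques `C_v` to cliques that contain the
parents of `v`, and then attach each retained clique `C` to a clique that contains `C ∩ S`. -/
def IsModifiedSubtree (net : BayesNet V D) (F : CliqueGraph V) (g : Finset V)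
    (U : Finset (Finset V)) (ST : CliqueGraph V) : Prop :=
  ∃ (H : SimpleGraph V) (ST₀ ST₁ : CliqueGraph V),
    net.elimGraph F g U ≤ H ∧
    (∀ x y, H.Adj x y → x ∈ net.elimVars F g U ∧ y ∈ net.elimVars F g U) ∧
    H.IsChordalGraph ∧
    ST₀.IsCliqueTreeOf H (net.elimVars F g U) ∧
    CliqueGraph.Attach net.family net.parents g ST₀ ST₁ ∧
    CliqueGraph.Attach (fun C => C) (fun C => C ∩ net.elimVars F g U)
      (net.retained F g U) ST₁ ST

/-- Steps 3.5, 4 and 5. `T'` is obtained from `T` when the subgraph `U` is replaced by `ST`: an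
edge between a clique `A ∉ U` and a clique `B ∈ U` becomes an edge between `A` and a clique
`gate A B` of `ST` that contains the sepset `A ∩ B`; factors of cliques in `U` that are not
retained are re-assigned to cliques in `ST` that contain their scope; and the conditional
probability distribution of each new variable `v` is assigned to `C_v`. -/
def IsReplacement (net : BayesNet V D) (ψ : J → Factor V D) (T : CTF V J) (g : Finset V)
    (U : Finset (Finset V)) (ST : CliqueGraph V) (T' : CTF V J) : Prop :=
  ∃ gate : Finset V → Finset V → Finset V,
    (∀ A B, A ∉ U → B ∈ U → T.graph.Adj A B → gate A B ∈ ST.nodes ∧ A ∩ B ⊆ gate A B) ∧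
    T'.nodes = (T.nodes \ U) ∪ ST.nodes ∧
    T'.graph = SimpleGraph.fromRel (fun A C =>
      (T.graph.Adj A C ∧ A ∉ U ∧ C ∉ U) ∨ ST.graph.Adj A C ∨
        ∃ B ∈ U, A ∉ U ∧ T.graph.Adj A B ∧ C = gate A B) ∧
    T'.factors = T.factors ∪ g.image Sum.inr ∧
    (∀ v ∈ g, T'.host (Sum.inr v) = net.family v) ∧
    (∀ i ∈ T.factors, (T.host i ∉ U ∨ T.host i ∈ net.retained T.toCliqueGraph g U) →
      T'.host i = T.host i) ∧
    (∀ i ∈ T.factors, T.host i ∈ U → T.host i ∉ net.retained T.toCliqueGraph g U →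
      T'.host i ∈ ST.nodes ∧ (net.factor ψ i).scope ⊆ T'.host i)

/-- `U` is the minimal subgraph `SG_min` for the group `g`: it connects, within each tree, the
minimal subgraphs of the variables in `g`. For a single variable it is the subgraph `MSG[Pa_v]`,
and for a group it is the union of these subgraphs whenever this union is connected within each
tree. -/
def IsGroupMSG (net : BayesNet V D) (F : CliqueGraph V) (g : Finset V)
    (U : Finset (Finset V)) : Prop :=
  ∃ m : V → Finset (Finset V),
    (∀ v ∈ g, F.IsMSG (net.parents v) (m v)) ∧ U = F.hull (g.biUnion m)

/-! The algorithm -/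

/-- Addition of the variable `v` in Case 1, where `U` is a single clique, and in Case 2, where `U`
is a set of disconnected cliques: `C_v` is connected to the cliques in `U`, and takes the place
and the factors of those that it contains. -/
noncomputable def addSimple (net : BayesNet V D) (T : CTF V J) (U : Finset (Finset V)) (v : V) :
    CTF V J :=
  open Classical in
  { T.toCliqueGraph.join U (net.family v) with
    factors := insert (Sum.inr v) T.factors
    host := fun i =>
      if i = Sum.inr v then net.family v
      else if T.host i ∈ U ∧ T.host i ⊆ net.family v then net.family v
      else T.host i }

/-- First loop of `ModifyCTF`, over the variables in `N` in any order: a variable is added if it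
belongs to Case 1 or Case 2. The last argument is the set of the remaining variables, which belong
to Case 3. -/
inductive SimpleLoop (net : BayesNet V D) :
    Finset V → CTF V J → CTF V J → Finset V → Prop
  | done (T : CTF V J) : SimpleLoop net ∅ T T ∅
  | add {N R : Finset V} {T T' : CTF V J} (v : V) (U : Finset (Finset V)) (hv : v ∈ N)
      (hU : T.IsMSG (net.parents v) U) (hcase : T.Disconnected U)
      (h : SimpleLoop net (N.erase v) (net.addSimple T U v) T' R) : SimpleLoop net N T T' R
  | skip {N R : Finset V} {T T' : CTF V J} (v : V) (U : Finset (Finset V)) (hv : v ∈ N)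
      (hU : T.IsMSG (net.parents v) U) (hcase : ¬ T.Disconnected U)
      (h : SimpleLoop net (N.erase v) T T' R) : SimpleLoop net N T T' (insert v R)

/-- `L` is the partition of `R` into groups of variables with overlapping minimal subgraphs. -/
def IsGrouping (net : BayesNet V D) (F : CliqueGraph V) (R : Finset V)
    (L : Finset (Finset V)) : Prop :=
  open Classical in
  ∃ m : V → Finset (Finset V), (∀ v ∈ R, F.IsMSG (net.parents v) (m v)) ∧
    L = R.image fun u => R.filter fun w =>
      Relation.ReflTransGen (fun a b => a ∈ R ∧ b ∈ R ∧ ¬ Disjoint (m a) (m b)) u w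

/-- Second loop of `ModifyCTF`, over the list `L` of groups. A group `g` is added if the cliques in
the modified subtree respect the bound `mcs`. Otherwise a smaller subset `Ns` is chosen, where
variables in `E` have priority, and the groups that it splits into are put back on the list. The
last argument is the set of the added variables. -/
inductive GroupLoop (net : BayesNet V D) (ψ : J → Factor V D) (mcs : ℝ) (E : Finset V) :
    Finset (Finset V) → CTF V J → CTF V J → Finset V → Prop
  | done (T : CTF V J) : GroupLoop net ψ mcs E ∅ T T ∅
  | add {L : Finset (Finset V)} {T T₁ T' : CTF V J} {Na : Finset V}
      (g : Finset V) (U : Finset (Finset V)) (ST : CliqueGraph V) (hg : g ∈ L)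
      (hU : net.IsGroupMSG T.toCliqueGraph g U)
      (hST : net.IsModifiedSubtree T.toCliqueGraph g U ST)
      (hsize : ∀ C ∈ ST.nodes, cliqueSize D C ≤ mcs)
      (hT₁ : net.IsReplacement ψ T g U ST T₁)
      (h : GroupLoop net ψ mcs E (L.erase g) T₁ T' Na) : GroupLoop net ψ mcs E L T T' (g ∪ Na)
  | split {L L' : Finset (Finset V)} {T T' : CTF V J} {Na : Finset V}
      (g Ns : Finset V) (U : Finset (Finset V)) (ST : CliqueGraph V) (hg : g ∈ L)
      (hU : net.IsGroupMSG T.toCliqueGraph g U)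
      (hST : net.IsModifiedSubtree T.toCliqueGraph g U ST)
      (hsize : ∃ C ∈ ST.nodes, mcs < cliqueSize D C)
      (hNs : Ns ⊂ g) (hprio : (∃ v ∈ g \ Ns, v ∈ E) → Ns ⊆ E)
      (hL' : net.IsGrouping T.toCliqueGraph Ns L')
      (h : GroupLoop net ψ mcs E (L.erase g ∪ L') T T' Na) : GroupLoop net ψ mcs E L T T' Na

/-- `ModifyCTF`, with input `T`, `N`, `mcs`, `E`. The output is the clique tree forest `T'` and the
subset `Na` of `N` of the variables that were added. -/
def ModifyCTF (net : BayesNet V D) (ψ : J → Factor V D) (mcs : ℝ) (T : CTF V J)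
    (N E : Finset V) (T' : CTF V J) (Na : Finset V) : Prop :=
  ∃ (T₁ : CTF V J) (R : Finset V) (L : Finset (Finset V)) (Ng : Finset V),
    SimpleLoop net N T T₁ R ∧ net.IsGrouping T₁.toCliqueGraph R L ∧
      GroupLoop net ψ mcs E L T₁ T' Ng ∧ Na = (N \ R) ∪ Ng

/-- The disjoint cliques over the variables in `PI`, each with the distribution of its variable. -/
def initialCTF (J : Type*) [DecidableEq J] (PI : Finset V) : CTF V J where
  nodes := PI.image fun v => {v}
  graph := ⊥
  factors := PI.image Sum.inr
  host := Sum.elim (fun _ => ∅) fun v => {v}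

/-- The variables in `G` with in-degree zero in `G`. -/
def sources (net : BayesNet V D) (G : Finset V) : Finset V :=
  G.filter fun v => Disjoint (net.parents v) G

/-- The variables in `N` of minimal topological level. -/
noncomputable def lowest (net : BayesNet V D) (N : Finset V) : Finset V :=
  N.filter fun v => ∀ w ∈ N, net.level v ≤ net.level w

/-- Main loop of `BuildCTF`. The state consists of the clique tree forest, the set of interface
variables, the set `G` of variables that are still to be added, the evidence variables among
them, and the set `Nact` of active variables; the last four arguments are the output. -/
inductive BuildLoop (net : BayesNet V D) (ψ : J → Factor V D) (mcs : ℝ) :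
    CTF V J → (IV G E Nact : Finset V) →
      CTF V J → (IV' G' E' : Finset V) → Prop
  | done (T : CTF V J) (IV G E : Finset V) : BuildLoop net ψ mcs T IV G E ∅ T IV G E
  | step {T T₁ T' : CTF V J} {IV G E Nact Na IV' G' E' : Finset V}
      (hact : Nact.Nonempty)
      (hmod : net.ModifyCTF ψ mcs T (net.lowest Nact) E T₁ Na)
      (h : BuildLoop net ψ mcs T₁
        (IV ∪ (net.lowest Nact \ Na).biUnion net.parents)
        (G \ Na) (E \ Na)
        ((Nact \ net.lowest Nact) ∪
          (net.sources (G \ Na)).filter fun w => ∃ u ∈ Na, u ∈ net.parents w)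
        T' IV' G' E') :
      BuildLoop net ψ mcs T IV G E Nact T' IV' G' E'

/-- `BuildCTF`, with input `T`, `G`, `E`, `mcs`, where `G` is the set of variables of the input DAG
(the subgraph of the network that is induced on it) and `E` the set of evidence variables. The
output is `T'`, the set `IV` of interface variables, the remaining DAG `G'`, and the remaining
evidence variables `E'`. -/
def BuildCTF (net : BayesNet V D) (ψ : J → Factor V D) (mcs : ℝ) (T : CTF V J)
    (G E : Finset V) (T' : CTF V J) (IV G' E' : Finset V) : Prop :=
  (T.nodes = ∅ ∧
      BuildLoop net ψ mcs (initialCTF J (net.sources G)) ∅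
        (G \ net.sources G) (E \ net.sources G) (net.sources (G \ net.sources G))
        T' IV G' E') ∨
    (T.nodes ≠ ∅ ∧ BuildLoop net ψ mcs T ∅ G E (net.sources G) T' IV G' E')

end
end BayesNet

/-! # Correctness of the clique tree forests built by `BuildCTF`

Forest and running intersection property. Both insertion steps of the algorithm replace a set `U` of
cliques by another forest `ST`: a single new clique with its neighbours in Cases 1 and 2, the
modified subtree in Case 3. The set `U` is path-convex, that is, it contains all paths between its
members (for hulls this is `SimpleGraph.IsAcyclic.isPathConvex_paths`, and pruning a leaf keeps it).
Growing `U` to the whole forest by one clique at a time keeps it path-convex, and each clique added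
in this way has at most one neighbour in the set built so far, whose sepset contains everything that
it shares with the set. Hence the same cliques can be added one by one, as leaves or isolated nodes,
to `ST` in place of `U`, which shows that the result is a forest with the running intersection
property (`CliqueGraph.IsForest.replace`). Attaching `C_v` or a retained clique is the special case
where `U` is one clique and `ST` a star, so that the modified subtree itself is such a forest.

Maximality. An attached clique always has a variable of its own and shares with the rest only
variables of the clique to which it is attached, so attaching keeps the cliques incomparable. For a
clique `A` outside `U`, all the variables that it shares with `U` lie in one clique `B` of `U`
(`CliqueGraph.IsForest.exists_inter_subset`). Thus `A` cannot be contained in a clique of `ST`, and a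
clique of `ST` contained in `A` would be a maximal clique `K` of the triangulated graph with
`K ⊆ B ∩ S`. As `B ∩ S` is complete, `K = B ∩ S`, which is impossible: if `B` is retained then `K` and
`B` are comparable cliques of `ST`, and otherwise `K = B` and `A` are comparable cliques of the old
forest (`BayesNet.IsAddable.isFitting`).

Distribution. Each step multiplies the joint distribution by the conditional distributions of the
added variables. The product of the assigned factors depends only on variables in the forest, and the
conditional distributions of the remaining variables sum up to one
(`BayesNet.sumOut_prod_cpd`), so this product is the marginal.

Termination. The complete graph on `S` is a chordal supergraph of the elimination graph with the
single maximal clique `S`, which is non-empty because a variable without parents is never left to the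
groups, so a modified subtree exists; a group that is too large can be split into its empty subset.
The main loop either removes variables from `G` or keeps `G` and removes active variables. -/

/-! ### Path-convex sets of vertices in forests -/

namespace SimpleGraph

variable {α : Type*} {G : SimpleGraph α}

theorem IsAcyclic.support_subset_of_isPath (hG : G.IsAcyclic) {a b : α} {p : G.Walk a b}
    (hp : p.IsPath) (q : G.Walk a b) : p.support ⊆ q.support := by
  classical
  have h : p = q.bypass := congrArg Subtype.val ((hG.subsingleton_path a b).elim ⟨p, hp⟩ q.toPath)
  rw [h]
  exact q.support_bypass_subset_support

theorem fromRel_congr {r s : α → α → Prop} (hrs : ∀ a b, a ≠ b → r a b → s a b ∨ s b a)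
    (hsr : ∀ a b, a ≠ b → s a b → r a b ∨ r b a) : fromRel r = fromRel s := by
  ext a b
  simp only [fromRel_adj]
  refine and_congr_right fun hne => ⟨?_, ?_⟩
  · rintro (h | h)
    · exact hrs a b hne h
    · exact (hrs b a hne.symm h).symm
  · rintro (h | h)
    · exact hsr a b hne h
    · exact (hsr b a hne.symm h).symm

/-- A set of vertices is path-convex if it contains every path between two of its vertices. -/
def IsPathConvex (G : SimpleGraph α) (W : Set α) : Prop :=
  ∀ a ∈ W, ∀ b ∈ W, ∀ p : G.Walk a b, p.IsPath → ∀ c ∈ p.support, c ∈ W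

namespace IsPathConvex

variable {W : Set α}

/-- A vertex outside a path-convex set has at most one neighbour in it. -/
theorem eq_of_adj (hW : G.IsPathConvex W) {a b c : α} (ha : a ∉ W) (hb : b ∈ W) (hc : c ∈ W)
    (hab : G.Adj a b) (hac : G.Adj a c) : b = c := by
  by_contra hbc
  refine ha (hW b hb c hc (.cons hab.symm (.cons hac .nil)) ?_ a (by simp))
  simp [hab.ne', hac.ne, hbc]

theorem insert_of_adj (hG : G.IsAcyclic) (hW : G.IsPathConvex W) {a b : α} (hb : b ∈ W)
    (hab : G.Adj a b) : G.IsPathConvex (insert a W) := by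
  classical
  have key : ∀ y ∈ W, ∀ p : G.Walk a y, p.IsPath → ∀ c ∈ p.support, c ∈ insert a W := by
    intro y hy p hp c hc
    have h := hG.support_subset_of_isPath hp
      (.cons hab ((Walk.cons hab.symm p).toPath : G.Walk b y)) hc
    rw [Walk.support_cons, List.mem_cons] at h
    exact h.imp id fun h => hW b hb y hy _ (Walk.cons hab.symm p).toPath.2 c h
  rintro x (rfl | hx) y (rfl | hy) p hp c hc
  · rw [Walk.nil_iff_support_eq.mp (Walk.isPath_iff_nil.mp hp)] at hc
    simp_all
  · exact key y hy p hp c hc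
  · exact key x hx p.reverse hp.reverse c (by simpa using hc)
  · exact Or.inr (hW x hx y hy p hp c hc)

theorem insert_of_isolated (hW : G.IsPathConvex W) (hiso : ∀ a ∉ W, ∀ b ∈ W, ¬ G.Adj a b) (a : α) :
    G.IsPathConvex (insert a W) := by
  by_cases ha : a ∈ W
  · rwa [Set.insert_eq_of_mem ha]
  have key : ∀ y ∈ W, G.Walk y a → False := by
    intro y hy p
    obtain ⟨d, -, h₁, h₂⟩ := p.exists_boundary_dart W hy ha
    exact hiso _ h₂ _ h₁ d.adj.symm
  rintro x (rfl | hx) y (rfl | hy) p hp c hc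
  · rw [Walk.nil_iff_support_eq.mp (Walk.isPath_iff_nil.mp hp)] at hc
    simp_all
  · exact (key y hy p.reverse).elim
  · exact (key x hx p).elim
  · exact Or.inr (hW x hx y hy p hp c hc)

/-- A path-convex set stays path-convex when a leaf is removed: an inner vertex of a path has two
neighbours on it. -/
theorem diff_singleton (hW : G.IsPathConvex W) {a b : α} (h : ∀ c ∈ W, G.Adj a c → c = b) :
    G.IsPathConvex (W \ {a}) := by
  classical
  rintro x ⟨hx, hxa⟩ y ⟨hy, hya⟩ p hp c hc
  refine ⟨hW x hx y hy p hp c hc, ?_⟩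
  rintro rfl
  have hsp := p.take_spec hc
  have hn₁ : ¬ (p.takeUntil c hc).Nil := fun hn => hxa hn.eq
  have hn₂ : ¬ (p.dropUntil c hc).Nil := fun hn => hya hn.eq.symm
  have h₁ : (p.takeUntil c hc).penultimate = b :=
    h _ (hW x hx y hy p hp _ (p.support_takeUntil_subset_support hc (Walk.getVert_mem_support _ _)))
      (Walk.adj_penultimate hn₁).symm
  have h₂ : (p.dropUntil c hc).snd = b :=
    h _ (hW x hx y hy p hp _ (p.support_dropUntil_subset_support hc (Walk.getVert_mem_support _ _)))
      (Walk.adj_snd hn₂)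
  have hnd := hp.support_nodup
  rw [← hsp, Walk.support_append, List.nodup_append] at hnd
  refine hnd.2.2 b (h₁ ▸ Walk.getVert_mem_support _ _) b ?_ rfl
  rw [← h₂]
  exact Walk.snd_mem_tail_support hn₂

/-- All walks from `a` into a path-convex set of a forest go through one gate `b`. -/
theorem exists_gate (hG : G.IsAcyclic) (hW : G.IsPathConvex W) {a c : α} (p : G.Walk a c)
    (hc : c ∈ W) : ∃ b ∈ W, ∀ c' ∈ W, ∀ q : G.Walk a c', b ∈ q.support := by
  classical
  induction p with
  | nil => exact ⟨_, hc, fun c' _ q => q.start_mem_support⟩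
  | @cons a z c haz p ih =>
    by_cases ha : a ∈ W
    · exact ⟨a, ha, fun c' _ q => q.start_mem_support⟩
    obtain ⟨b, hb, h⟩ := ih hc
    refine ⟨b, hb, fun c' hc' q => ?_⟩
    have hbq := h c' hc' (.cons haz.symm q)
    rw [Walk.support_cons, List.mem_cons] at hbq
    rcases hbq with rfl | hbq
    · have hr := hW b hb c' hc' _ (Walk.cons haz.symm q).toPath.2
      have hpath : (Walk.cons haz ((Walk.cons haz.symm q).toPath : G.Walk b c')).IsPath :=
        .cons (Walk.cons haz.symm q).toPath.2 fun h => ha (hr _ h)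
      exact hG.support_subset_of_isPath hpath q (by simp)
    · exact hbq

end IsPathConvex

/-- In a forest, the union of all paths between vertices of `U` is path-convex. -/
theorem IsAcyclic.isPathConvex_paths (hG : G.IsAcyclic) (U : Set α) :
    G.IsPathConvex {c | ∃ a ∈ U, ∃ b ∈ U, ∃ p : G.Walk a b, p.IsPath ∧ c ∈ p.support} := by
  classical
  -- from `x`, an end of its path can be reached without meeting `c`
  have key : ∀ c x, c ≠ x →
      (∃ a ∈ U, ∃ b ∈ U, ∃ p : G.Walk a b, p.IsPath ∧ x ∈ p.support) →
      ∃ a ∈ U, ∃ q : G.Walk x a, c ∉ q.support := by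
    rintro c x hcx ⟨a, ha, b, hb, p, hp, hx⟩
    by_contra! hcon
    have h₁ := hcon a ha (p.takeUntil x hx).reverse
    have h₂ := hcon b hb (p.dropUntil x hx)
    have hnd := hp.support_nodup
    rw [← p.take_spec hx, Walk.support_append, List.nodup_append] at hnd
    rw [Walk.support_reverse, List.mem_reverse] at h₁
    rw [Walk.mem_support_iff] at h₂
    exact hnd.2.2 c h₁ c (h₂.resolve_left hcx) rfl
  intro x hx y hy p hp c hc
  by_cases hcx : c = x
  · exact hcx ▸ hx
  by_cases hcy : c = y
  · exact hcy ▸ hy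
  obtain ⟨a, ha, q, hq⟩ := key c x hcx hx
  obtain ⟨b, hb, r, hr⟩ := key c y hcy hy
  refine ⟨a, ha, b, hb, (q.reverse.append (p.append r)).toPath,
    (q.reverse.append (p.append r)).toPath.2, ?_⟩
  set s := (q.reverse.append (p.append r)).toPath
  have h := hG.support_subset_of_isPath hp (q.append (s.1.append r.reverse)) hc
  simp only [Walk.mem_support_append_iff, Walk.support_reverse, List.mem_reverse] at h
  tauto

end SimpleGraph

/-! ### Replacing a part of a forest with the running intersection property -/

namespace CliqueGraph

section

variable {V : Type*} {F : CliqueGraph V} {A B : Finset V}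

/-- In an acyclic graph it suffices, for the running intersection property, to have some walk
through cliques that contain the shared variable. -/
theorem IsForest.of_walks (hedge : ∀ A B, F.graph.Adj A B → A ∈ F.nodes ∧ B ∈ F.nodes)
    (hac : F.graph.IsAcyclic)
    (h : ∀ x, ∀ A ∈ F.nodes, ∀ B ∈ F.nodes, x ∈ A → x ∈ B →
      ∃ p : F.graph.Walk A B, ∀ C ∈ p.support, x ∈ C) : F.IsForest where
  edge_mem := hedge
  acyclic := hac
  running x A hA B hB hxA hxB := by
    obtain ⟨p, hp⟩ := h x A hA B hB hxA hxB
    exact ⟨⟨p⟩, fun q hq C hC => hp C (hac.support_subset_of_isPath hq p hC)⟩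

/-- The part of a clique graph on the nodes `N`. -/
def restrict (F : CliqueGraph V) (N : Finset (Finset V)) : CliqueGraph V where
  nodes := N
  graph :=
    { Adj := fun A B => F.graph.Adj A B ∧ A ∈ N ∧ B ∈ N
      symm := ⟨fun _ _ h => ⟨h.1.symm, h.2.2, h.2.1⟩⟩
      loopless := ⟨fun _ h => h.1.ne rfl⟩ }

theorem restrict_adj {N : Finset (Finset V)} :
    (F.restrict N).graph.Adj A B ↔ F.graph.Adj A B ∧ A ∈ N ∧ B ∈ N := Iff.rfl

end

variable {V : Type*} [DecidableEq V] {F F' ST : CliqueGraph V} {U W : Finset (Finset V)}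
  {A B C : Finset V} {x : V}

theorem mem_vars : x ∈ F.vars ↔ ∃ C ∈ F.nodes, x ∈ C := by simp [vars]

namespace IsForest

theorem exists_walk (hF : F.IsForest) (hA : A ∈ F.nodes) (hB : B ∈ F.nodes) (hxA : x ∈ A)
    (hxB : x ∈ B) : ∃ p : F.graph.Walk A B, ∀ C ∈ p.support, x ∈ C := by
  classical
  obtain ⟨⟨p⟩, h⟩ := hF.running x A hA B hB hxA hxB
  exact ⟨p.toPath, h _ p.toPath.2⟩

/-- The variables which a clique `A` shares with the cliques of a path-convex set `W` are all in one
clique of `W`. -/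
theorem exists_inter_subset (hF : F.IsForest) (hW : F.graph.IsPathConvex (W : Set (Finset V)))
    (hWF : W ⊆ F.nodes) (hA : A ∈ F.nodes) (hC : C ∈ W) (hxA : x ∈ A) (hxC : x ∈ C) :
    ∃ B ∈ W, ∀ y ∈ A, (∃ C' ∈ W, y ∈ C') → y ∈ B := by
  classical
  obtain ⟨p, -⟩ := hF.exists_walk hA (hWF hC) hxA hxC
  obtain ⟨B, hB, h⟩ := hW.exists_gate hF.acyclic p hC
  refine ⟨B, hB, ?_⟩
  rintro y hyA ⟨C', hC', hyC'⟩
  obtain ⟨q, hq⟩ := hF.exists_walk hA (hWF hC') hyA hyC'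
  exact hq B (h C' hC' q)

/-- If `A` is adjacent to a clique `B` of a path-convex set `W` that does not contain `A`, then the
variables which `A` shares with the cliques in `W` are in `B`. -/
theorem mem_of_adj (hF : F.IsForest) (hW : F.graph.IsPathConvex (W : Set (Finset V)))
    (hWF : W ⊆ F.nodes) (hA : A ∉ W) (hB : B ∈ W) (hAB : F.graph.Adj A B) (hC : C ∈ W)
    (hxA : x ∈ A) (hxC : x ∈ C) : x ∈ B := by
  obtain ⟨B', hB', h⟩ := hW.exists_gate hF.acyclic hAB.toWalk hB
  obtain rfl : B' = B := by
    rcases (by simpa using h B hB hAB.toWalk : B' = A ∨ B' = B) with rfl | h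
    · exact (hA hB').elim
    · exact h
  obtain ⟨q, hq⟩ := hF.exists_walk (hF.edge_mem _ _ hAB).1 (hWF hC) hxA hxC
  exact hq B' (h C hC q)

/-- Addition of a leaf `B` with neighbour `C`. -/
theorem of_leaf (hF : F.IsForest) (hB : B ∉ F.nodes) (hC : C ∈ F.nodes)
    (hn : F'.nodes = insert B F.nodes)
    (hadj : ∀ X Y, F'.graph.Adj X Y ↔
      F.graph.Adj X Y ∨ (X = B ∧ Y = C) ∨ (X = C ∧ Y = B))
    (hsub : ∀ x ∈ B, x ∈ F.vars → x ∈ C) : F'.IsForest := by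
  have hBC : B ≠ C := fun h => hB (h ▸ hC)
  have hgr : F'.graph = F.graph ⊔ SimpleGraph.edge B C := by
    ext X Y
    rw [hadj, SimpleGraph.sup_adj, SimpleGraph.edge_adj]
    grind
  have hle : F.graph ≤ F'.graph := hgr ▸ le_sup_left
  have hadjBC : F'.graph.Adj B C := (hadj B C).2 (Or.inr (Or.inl ⟨rfl, rfl⟩))
  have hold : ∀ x, ∀ X ∈ F.nodes, ∀ Y ∈ F.nodes, x ∈ X → x ∈ Y →
      ∃ p : F'.graph.Walk X Y, ∀ Z ∈ p.support, x ∈ Z := by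
    intro x X hX Y hY hxX hxY
    obtain ⟨p, hp⟩ := hF.exists_walk hX hY hxX hxY
    exact ⟨p.mapLe hle, by simpa using hp⟩
  have hnew : ∀ x, ∀ Y ∈ F.nodes, x ∈ B → x ∈ Y →
      ∃ p : F'.graph.Walk B Y, ∀ Z ∈ p.support, x ∈ Z := by
    intro x Y hY hxB hxY
    obtain ⟨p, hp⟩ := hold x C hC Y hY (hsub x hxB (mem_vars.2 ⟨Y, hY, hxY⟩)) hxY
    exact ⟨.cons hadjBC p, by simpa [hxB] using hp⟩
  refine of_walks ?_ ?_ ?_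
  · intro X Y h
    rw [hn]
    rcases (hadj X Y).1 h with h | ⟨rfl, rfl⟩ | ⟨rfl, rfl⟩
    · have := hF.edge_mem _ _ h
      simp [this]
    · simp [hC]
    · simp [hC]
  · rw [hgr]
    refine SimpleGraph.IsAcyclic.sup_edge_of_not_reachable ?_ hF.acyclic
    rintro ⟨p⟩
    cases p with
    | nil => exact hBC rfl
    | cons h _ => exact hB (hF.edge_mem _ _ h).1
  · rw [hn]
    intro x X hX Y hY hxX hxY
    rw [Finset.mem_insert] at hX hY
    rcases hX with rfl | hX <;> rcases hY with rfl | hY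
    · exact ⟨.nil, by simpa using hxX⟩
    · exact hnew x Y hY hxX hxY
    · obtain ⟨p, hp⟩ := hnew x X hX hxY hxX
      exact ⟨p.reverse, by simpa using hp⟩
    · exact hold x X hX Y hY hxX hxY

/-- Addition of an isolated clique. -/
theorem of_isolated (hF : F.IsForest) (hn : F'.nodes = insert B F.nodes)
    (hgr : F'.graph = F.graph) (hsub : ∀ x ∈ B, x ∉ F.vars) : F'.IsForest := by
  refine of_walks ?_ (hgr ▸ hF.acyclic) ?_
  · intro X Y h
    rw [hgr] at h
    rw [hn]
    exact ⟨Finset.mem_insert_of_mem (hF.edge_mem _ _ h).1,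
      Finset.mem_insert_of_mem (hF.edge_mem _ _ h).2⟩
  · rw [hn, hgr]
    intro x X hX Y hY hxX hxY
    rw [Finset.mem_insert] at hX hY
    rcases hX with rfl | hX <;> rcases hY with rfl | hY
    · exact ⟨.nil, by simpa using hxX⟩
    · exact (hsub x hxX (mem_vars.2 ⟨_, hY, hxY⟩)).elim
    · exact (hsub x hxY (mem_vars.2 ⟨_, hX, hxX⟩)).elim
    · exact hF.exists_walk hX hY hxX hxY

end IsForest

/-- A path-convex part `U` of a forest can be replaced by another forest `ST`, if each edge from
outside into `U` is redirected to a clique which contains its sepset, and if the variables shared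
by `ST` and the old forest occur in `U`. The cliques outside `U` can be added to `ST` one by one,
as leaves or isolated nodes, because each has at most one neighbour in a path-convex set. -/
theorem IsForest.replace (hF : F.IsForest) (hST : ST.IsForest) (hU : U ⊆ F.nodes)
    (hconv : F.graph.IsPathConvex (U : Set (Finset V))) (gate : Finset V → Finset V → Finset V)
    (hgate : ∀ A B, A ∉ U → B ∈ U → F.graph.Adj A B →
      gate A B ∈ ST.nodes ∧ A ∩ B ⊆ gate A B)
    (hnodes : F'.nodes = (F.nodes \ U) ∪ ST.nodes)
    (hgraph : F'.graph = SimpleGraph.fromRel (fun A C =>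
      (F.graph.Adj A C ∧ A ∉ U ∧ C ∉ U) ∨ ST.graph.Adj A C ∨
        ∃ B ∈ U, A ∉ U ∧ F.graph.Adj A B ∧ C = gate A B))
    (hdisj : ∀ A ∈ F.nodes, A ∉ U → A ∉ ST.nodes)
    (hvars : ∀ x ∈ ST.vars, x ∈ F.vars → ∃ C ∈ U, x ∈ C) : F'.IsForest := by
  have hadj_old : ∀ A ∈ F.nodes, A ∉ U → ∀ Y, F'.graph.Adj A Y ↔
      (F.graph.Adj A Y ∧ Y ∉ U) ∨ ∃ B ∈ U, F.graph.Adj A B ∧ Y = gate A B := by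
    intro A hA hAU Y
    have hAS := hdisj A hA hAU
    rw [hgraph, SimpleGraph.fromRel_adj]
    constructor
    · rintro ⟨-, (⟨h, -, hY⟩ | h | ⟨B, hB, -, h, h'⟩) | ⟨h, hY, -⟩ | h | ⟨B, hB, hY, h, h'⟩⟩
      · exact Or.inl ⟨h, hY⟩
      · exact (hAS (hST.edge_mem _ _ h).1).elim
      · exact Or.inr ⟨B, hB, h, h'⟩
      · exact Or.inl ⟨h.symm, hY⟩
      · exact (hAS (hST.edge_mem _ _ h).2).elim
      · exact (hAS (h' ▸ (hgate Y B hY hB h).1)).elim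
    · rintro (⟨h, hY⟩ | ⟨B, hB, h, rfl⟩)
      · exact ⟨h.ne, Or.inl (Or.inl ⟨h, hAU, hY⟩)⟩
      · exact ⟨fun h' => hAS (h' ▸ (hgate A B hAU hB h).1),
          Or.inl (Or.inr (Or.inr ⟨B, hB, hAU, h, rfl⟩))⟩
  have hadj_ST : ∀ X ∈ ST.nodes, ∀ Y ∈ ST.nodes, F'.graph.Adj X Y ↔ ST.graph.Adj X Y := by
    intro X hX Y hY
    rw [hgraph, SimpleGraph.fromRel_adj]
    constructor
    · rintro ⟨-, (⟨h, hXU, -⟩ | h | ⟨B, hB, hXU, h, h'⟩) |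
        ⟨h, hYU, -⟩ | h | ⟨B, hB, hYU, h, h'⟩⟩
      · exact (hdisj X (hF.edge_mem _ _ h).1 hXU hX).elim
      · exact h
      · exact (hdisj X (hF.edge_mem _ _ h).1 hXU hX).elim
      · exact (hdisj Y (hF.edge_mem _ _ h).1 hYU hY).elim
      · exact h.symm
      · exact (hdisj Y (hF.edge_mem _ _ h).1 hYU hY).elim
    · exact fun h => ⟨h.ne, Or.inl (Or.inr (Or.inl h))⟩
  have hedge : ∀ X Y, F'.graph.Adj X Y → X ∈ F'.nodes ∧ Y ∈ F'.nodes := by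
    intro X Y
    rw [hgraph, SimpleGraph.fromRel_adj, hnodes]
    simp only [Finset.mem_union, Finset.mem_sdiff]
    rintro ⟨-, (⟨h, h₁, h₂⟩ | h | ⟨B, hB, h₁, h, rfl⟩) |
        ⟨h, h₁, h₂⟩ | h | ⟨B, hB, h₁, h, rfl⟩⟩
    · exact ⟨Or.inl ⟨(hF.edge_mem _ _ h).1, h₁⟩, Or.inl ⟨(hF.edge_mem _ _ h).2, h₂⟩⟩
    · exact ⟨Or.inr (hST.edge_mem _ _ h).1, Or.inr (hST.edge_mem _ _ h).2⟩
    · exact ⟨Or.inl ⟨(hF.edge_mem _ _ h).1, h₁⟩, Or.inr (hgate _ _ h₁ hB h).1⟩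
    · exact ⟨Or.inl ⟨(hF.edge_mem _ _ h).2, h₂⟩, Or.inl ⟨(hF.edge_mem _ _ h).1, h₁⟩⟩
    · exact ⟨Or.inr (hST.edge_mem _ _ h).2, Or.inr (hST.edge_mem _ _ h).1⟩
    · exact ⟨Or.inr (hgate _ _ h₁ hB h).1, Or.inl ⟨(hF.edge_mem _ _ h).1, h₁⟩⟩
  have main : ∀ n : ℕ, ∀ W : Finset (Finset V), (F.nodes \ W).card = n → U ⊆ W → W ⊆ F.nodes →
      F.graph.IsPathConvex (W : Set (Finset V)) →
      (F'.restrict ((W \ U) ∪ ST.nodes)).IsForest → F'.IsForest := by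
    intro n
    induction n with
    | zero =>
      intro W hcard hUW hWF _ hres
      have hW : W = F.nodes := hWF.antisymm (Finset.sdiff_eq_empty_iff_subset.1
        (Finset.card_eq_zero.1 hcard))
      rw [hW, ← hnodes] at hres
      have hgr : (F'.restrict F'.nodes).graph = F'.graph := by
        ext X Y
        exact ⟨fun h => h.1, fun h => ⟨h, hedge X Y h⟩⟩
      have : F'.restrict F'.nodes = F' := by
        conv_rhs => rw [show F' = ⟨F'.nodes, F'.graph⟩ from rfl, ← hgr]
        rfl
      rwa [this] at hres
    | succ n ih =>
      intro W hcard hUW hWF hW hres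
      have hshare : ∀ A ∈ F.nodes, ∀ x ∈ A, x ∈ (F'.restrict ((W \ U) ∪ ST.nodes)).vars →
          ∃ C ∈ W, x ∈ C := by
        intro A hA x hxA hx
        obtain ⟨C, hC, hxC⟩ := mem_vars.1 hx
        rcases Finset.mem_union.1 hC with hC | hC
        · exact ⟨C, (Finset.mem_sdiff.1 hC).1, hxC⟩
        · obtain ⟨C', hC', hx'⟩ := hvars x (mem_vars.2 ⟨C, hC, hxC⟩) (mem_vars.2 ⟨A, hA, hxA⟩)
          exact ⟨C', hUW hC', hx'⟩
      have hnode : ∀ A ∈ F.nodes, A ∉ W →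
          A ∉ (W \ U) ∪ ST.nodes ∧ (insert A W \ U) ∪ ST.nodes = insert A ((W \ U) ∪ ST.nodes) := by
        intro A hA hAW
        have h₁ : A ∉ U := fun h => hAW (hUW h)
        have h₂ := hdisj A hA h₁
        constructor
        · simp [hAW, h₂]
        · rw [Finset.insert_sdiff_of_notMem _ h₁, Finset.insert_union]
      have hcard' : ∀ A ∈ F.nodes, A ∉ W → (F.nodes \ insert A W).card = n := by
        intro A hA hAW
        rw [Finset.sdiff_insert, Finset.card_erase_of_mem (Finset.mem_sdiff.2 ⟨hA, hAW⟩), hcard]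
        rfl
      by_cases hex : ∃ A, A ∉ W ∧ ∃ B ∈ W, F.graph.Adj A B
      · obtain ⟨A, hAW, B, hBW, hAB⟩ := hex
        have hA := (hF.edge_mem _ _ hAB).1
        have hAU : A ∉ U := fun h => hAW (hUW h)
        obtain ⟨hA', hins⟩ := hnode A hA hAW
        refine ih (insert A W) (hcard' A hA hAW) (hUW.trans (Finset.subset_insert _ _))
          (Finset.insert_subset hA hWF) ?_ ?_
        · rw [Finset.coe_insert]
          exact hW.insert_of_adj hF.acyclic hBW hAB
        rw [hins]
        -- the only neighbour of `A` among the nodes already present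
        let C := if B ∈ U then gate A B else B
        have hC : C ∈ (W \ U) ∪ ST.nodes := by
          by_cases hB : B ∈ U
          · simp [C, hB, (hgate A B hAU hB hAB).1]
          · simp [C, hB, hBW]
        have hAC : ∀ Y ∈ (W \ U) ∪ ST.nodes, F'.graph.Adj A Y ↔ Y = C := by
          intro Y hY
          rw [hadj_old A hA hAU]
          constructor
          · rintro (⟨h, hYU⟩ | ⟨B', hB', h, rfl⟩)
            · have hYW : Y ∈ W := by
                rcases Finset.mem_union.1 hY with hY | hY
                · exact (Finset.mem_sdiff.1 hY).1
                · exact (hdisj Y (hF.edge_mem _ _ h).2 hYU hY).elim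
              obtain rfl := hW.eq_of_adj hAW hBW hYW hAB h
              simp [C, hYU]
            · obtain rfl := hW.eq_of_adj hAW hBW (hUW hB') hAB h
              simp [C, hB']
          · rintro rfl
            by_cases hB : B ∈ U
            · exact Or.inr ⟨B, hB, hAB, by simp [C, hB]⟩
            · left
              simp [C, hB, hAB]
        refine hres.of_leaf (B := A) (C := C) hA' hC rfl ?_ ?_
        · intro X Y
          simp only [restrict_adj, Finset.mem_insert]
          constructor
          · rintro ⟨h, rfl | hX, rfl | hY⟩
            · exact (h.ne rfl).elim
            · exact Or.inr (Or.inl ⟨rfl, (hAC Y hY).1 h⟩)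
            · exact Or.inr (Or.inr ⟨(hAC X hX).1 h.symm, rfl⟩)
            · exact Or.inl ⟨h, hX, hY⟩
          · rintro (⟨h, hX, hY⟩ | ⟨rfl, rfl⟩ | ⟨rfl, rfl⟩)
            · exact ⟨h, Or.inr hX, Or.inr hY⟩
            · exact ⟨(hAC _ hC).2 rfl, Or.inl rfl, Or.inr hC⟩
            · exact ⟨((hAC _ hC).2 rfl).symm, Or.inr hC, Or.inl rfl⟩
        · intro x hxA hx
          obtain ⟨C', hC', hxC'⟩ := hshare A hA x hxA hx
          have hxB := hF.mem_of_adj hW hWF hAW hBW hAB hC' hxA hxC'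
          by_cases hB : B ∈ U
          · simpa [C, hB] using (hgate A B hAU hB hAB).2 (Finset.mem_inter.2 ⟨hxA, hxB⟩)
          · simpa [C, hB] using hxB
      · push Not at hex
        obtain ⟨A, hA⟩ : (F.nodes \ W).Nonempty := by
          rw [← Finset.card_pos, hcard]
          exact Nat.succ_pos n
        obtain ⟨hA, hAW⟩ := Finset.mem_sdiff.1 hA
        have hAU : A ∉ U := fun h => hAW (hUW h)
        obtain ⟨hA', hins⟩ := hnode A hA hAW
        refine ih (insert A W) (hcard' A hA hAW) (hUW.trans (Finset.subset_insert _ _))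
          (Finset.insert_subset hA hWF) ?_ ?_
        · rw [Finset.coe_insert]
          exact hW.insert_of_isolated hex A
        rw [hins]
        have hAC : ∀ Y ∈ (W \ U) ∪ ST.nodes, ¬ F'.graph.Adj A Y := by
          intro Y hY
          rw [hadj_old A hA hAU]
          rintro (⟨h, hYU⟩ | ⟨B', hB', h, rfl⟩)
          · rcases Finset.mem_union.1 hY with hY | hY
            · exact hex A hAW Y (Finset.mem_sdiff.1 hY).1 h
            · exact (hdisj Y (hF.edge_mem _ _ h).2 hYU hY).elim
          · exact hex A hAW B' (hUW hB') h
        refine hres.of_isolated (B := A) rfl ?_ ?_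
        · ext X Y
          simp only [restrict_adj, Finset.mem_insert]
          constructor
          · rintro ⟨h, rfl | hX, rfl | hY⟩
            · exact (h.ne rfl).elim
            · exact (hAC Y hY h).elim
            · exact (hAC X hX h.symm).elim
            · exact ⟨h, hX, hY⟩
          · rintro ⟨h, hX, hY⟩
            exact ⟨h, Or.inr hX, Or.inr hY⟩
        · intro x hxA hx
          obtain ⟨C', hC', hxC'⟩ := hshare A hA x hxA hx
          obtain ⟨⟨p⟩, -⟩ := hF.running x C' (hWF hC') A hA hxC' hxA
          obtain ⟨d, -, h₁, h₂⟩ := p.exists_boundary_dart (W : Set (Finset V)) hC' hAW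
          exact hex _ h₂ _ h₁ d.adj.symm
  refine main _ U rfl subset_rfl hU hconv ?_
  rw [Finset.sdiff_self, Finset.empty_union]
  have hgr : (F'.restrict ST.nodes).graph = ST.graph := by
    ext X Y
    exact ⟨fun h => (hadj_ST X h.2.1 Y h.2.2).1 h.1, fun h => ⟨(hadj_ST X (hST.edge_mem _ _ h).1 Y
      (hST.edge_mem _ _ h).2).2 h, hST.edge_mem _ _ h⟩⟩
  have : F'.restrict ST.nodes = ST := by
    conv_rhs => rw [show ST = ⟨ST.nodes, ST.graph⟩ from rfl, ← hgr]
    rfl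
  rwa [this]

/-- The star with centre `B` and leaves `K`. -/
def star (B : Finset V) (K : Finset (Finset V)) : CliqueGraph V where
  nodes := insert B K
  graph := SimpleGraph.fromRel fun X Y => X = B ∧ Y ∈ K

theorem isForest_star {K : Finset (Finset V)} (hB : B ∉ K)
    (hK : ∀ C ∈ K, ∀ C' ∈ K, C ≠ C' → C ∩ C' ⊆ B) : (star B K).IsForest := by
  induction K using Finset.induction_on with
  | empty =>
    refine IsForest.of_walks ?_ ?_ ?_
    · intro X Y h
      simp [star, SimpleGraph.fromRel_adj] at h
    · have : (star B ∅).graph = ⊥ := by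
        ext X Y
        simp [star, SimpleGraph.fromRel_adj]
      rw [this]
      exact SimpleGraph.isAcyclic_bot
    · intro x X hX Y hY hxX hxY
      simp only [star, insert_empty_eq, Finset.mem_singleton] at hX hY
      subst hX hY
      exact ⟨.nil, by simpa using hxX⟩
  | insert C K hC ih =>
    have hBC : B ≠ C := fun h => hB (by simp [h])
    have hBK : B ∉ K := fun h => hB (Finset.mem_insert_of_mem h)
    refine (ih hBK fun A hA A' hA' => hK A (Finset.mem_insert_of_mem hA) A'
      (Finset.mem_insert_of_mem hA')).of_leaf (B := C) (C := B) ?_ ?_ ?_ ?_ ?_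
    · simp [star, hBC.symm, hC]
    · simp [star]
    · simp [star, Finset.insert_comm]
    · intro X Y
      simp only [star, SimpleGraph.fromRel_adj, Finset.mem_insert]
      grind
    · intro x hxC hx
      obtain ⟨A, hA, hxA⟩ := mem_vars.1 hx
      rcases Finset.mem_insert.1 hA with rfl | hA
      · exact hxA
      · exact hK C (Finset.mem_insert_self _ _) A (Finset.mem_insert_of_mem hA)
          (fun h => hC (h ▸ hA)) (Finset.mem_inter.2 ⟨hxC, hxA⟩)

/-- Connecting a new clique `B` to pairwise disconnected cliques `U`, with absorption of those
contained in `B`, is the replacement of `U` by a star. -/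
theorem IsForest.join (hF : F.IsForest) (hU : U ⊆ F.nodes)
    (hconv : F.graph.IsPathConvex (U : Set (Finset V))) (hdis : F.Disconnected U)
    (hB : B ∉ F.nodes) (hvars : ∀ x ∈ B, x ∈ F.vars → ∃ C ∈ U, x ∈ C) : (F.join U B).IsForest := by
  classical
  have hBU : B ∉ U := fun h => hB (hU h)
  set K := U.filter fun C => ¬ C ⊆ B with hK
  have hmemK : ∀ C, C ∈ K ↔ C ∈ U ∧ ¬ C ⊆ B := by simp [hK]
  have hstar : (star B K).IsForest := by
    refine isForest_star (by simp [hmemK]) ?_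
    intro C hC C' hC' hne x hx
    obtain ⟨hxC, hxC'⟩ := Finset.mem_inter.1 hx
    have hCU := ((hmemK C).1 hC).1
    have hCU' := ((hmemK C').1 hC').1
    obtain ⟨⟨p⟩, -⟩ := hF.running x C (hU hCU) C' (hU hCU') hxC hxC'
    have hp := hconv C hCU C' hCU' p.toPath p.toPath.2
    exfalso
    generalize (p.toPath : F.graph.Walk C C') = q at hp
    cases q with
    | nil => exact hne rfl
    | @cons _ Z _ h q => exact hdis C hCU Z (hp Z (by simp)) h
  refine hF.replace hstar hU hconv (fun _ R => if R ⊆ B then B else R) ?_ ?_ ?_ ?_ ?_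
  · intro A R _ hR _
    by_cases hRB : R ⊆ B
    · simp only [hRB, if_true]
      exact ⟨Finset.mem_insert_self _ _, Finset.inter_subset_right.trans hRB⟩
    · simp only [hRB, if_false]
      exact ⟨Finset.mem_insert_of_mem ((hmemK R).2 ⟨hR, hRB⟩), Finset.inter_subset_right⟩
  · ext X
    simp only [CliqueGraph.join, star, Finset.mem_insert, Finset.mem_filter, Finset.mem_union,
      Finset.mem_sdiff, hmemK]
    have := @hU X
    tauto
  · refine SimpleGraph.fromRel_congr ?_ ?_
    · rintro A C hAC (⟨h, hA, hC⟩ | ⟨rfl, hC, hCU | ⟨R, hR, hRB, h⟩⟩)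
      · by_cases hAU : A ∈ U
        · exact Or.inr (Or.inr (Or.inr ⟨A, hAU, fun hCU => hdis A hAU C hCU h, h.symm,
            by rw [if_neg fun h' => hA ⟨hAU, h'⟩]⟩))
        · by_cases hCU : C ∈ U
          · exact Or.inl (Or.inr (Or.inr ⟨C, hCU, hAU, h,
              by rw [if_neg fun h' => hC ⟨hCU, h'⟩]⟩))
          · exact Or.inl (Or.inl ⟨h, hAU, hCU⟩)
      · exact Or.inl (Or.inr (Or.inl
          ⟨hAC, Or.inl ⟨rfl, (hmemK C).2 ⟨hCU, fun h => hC ⟨hCU, h⟩⟩⟩⟩))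
      · exact Or.inr (Or.inr (Or.inr ⟨R, hR, fun hCU => hdis R hR C hCU h, h.symm,
          by rw [if_pos hRB]⟩))
    · rintro A C hAC (⟨h, hA, hC⟩ | ⟨-, ⟨rfl, hC⟩ | ⟨rfl, hA⟩⟩ | ⟨R, hR, hA, h, rfl⟩)
      · exact Or.inl (Or.inl ⟨h, fun h => hA h.1, fun h => hC h.1⟩)
      · rw [hmemK] at hC
        exact Or.inl (Or.inr ⟨rfl, fun h => hC.2 h.2, Or.inl hC.1⟩)
      · rw [hmemK] at hA
        exact Or.inr (Or.inr ⟨rfl, fun h => hA.2 h.2, Or.inl hA.1⟩)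
      · by_cases hRB : R ⊆ B
        · rw [if_pos hRB]
          exact Or.inr (Or.inr ⟨rfl, fun h => hA h.1, Or.inr ⟨R, hR, hRB, h.symm⟩⟩)
        · rw [if_neg hRB]
          exact Or.inl (Or.inl ⟨h, fun h => hA h.1, fun h => hRB h.2⟩)
  · intro A hA hAU hA'
    rcases Finset.mem_insert.1 hA' with rfl | h
    · exact hB hA
    · exact hAU ((hmemK A).1 h).1
  · intro x hx hxF
    obtain ⟨C, hC, hxC⟩ := mem_vars.1 hx
    rcases Finset.mem_insert.1 hC with rfl | h
    · exact hvars x hxC hxF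
    · exact ⟨C, ((hmemK C).1 h).1, hxC⟩

end CliqueGraph

/-! ### Hulls and minimal subgraphs -/

namespace CliqueGraph

section

variable {V : Type*} {F : CliqueGraph V} {A B : Finset V} {U : Finset (Finset V)}

theorem mem_nodes_of_mem_support (hedge : ∀ A B, F.graph.Adj A B → A ∈ F.nodes ∧ B ∈ F.nodes)
    (hA : A ∈ F.nodes) (p : F.graph.Walk A B) : ∀ C ∈ p.support, C ∈ F.nodes := by
  induction p with
  | nil => simpa using hA
  | cons h p ih =>
    intro C hC
    rcases List.mem_cons.1 hC with rfl | hC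
    · exact hA
    · exact ih (hedge _ _ h).2 C hC

theorem hull_subset (F : CliqueGraph V) (U : Finset (Finset V)) : F.hull U ⊆ F.nodes := by
  classical
  exact Finset.filter_subset _ _

theorem subset_hull (hU : U ⊆ F.nodes) : U ⊆ F.hull U := by
  classical
  intro C hC
  exact Finset.mem_filter.2 ⟨hU hC, C, hC, C, hC, .nil, by simp⟩

theorem IsForest.isPathConvex_hull (hF : F.IsForest) (hU : U ⊆ F.nodes) :
    F.graph.IsPathConvex (F.hull U : Set (Finset V)) := by
  convert hF.acyclic.isPathConvex_paths (U : Set (Finset V)) using 1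
  ext C
  simp only [hull, Finset.coe_filter, Set.mem_ofPred_eq, Finset.mem_coe, and_iff_right_iff_imp]
  rintro ⟨A, hA, B, hB, p, -, hC⟩
  exact mem_nodes_of_mem_support hF.edge_mem (hU hA) p C hC

end

variable {V : Type*} [DecidableEq V] {F F' : CliqueGraph V} {U : Finset (Finset V)}
  {B P : Finset V}

/-- The graph of a valid clique tree forest: a forest with the running intersection property whose
cliques are non-empty and pairwise incomparable. -/
structure IsCliqueForest (F : CliqueGraph V) : Prop extends F.IsForest where
  nonempty : ∀ C ∈ F.nodes, C.Nonempty
  maximal : ∀ A ∈ F.nodes, ∀ B ∈ F.nodes, A ⊆ B → A = B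

theorem exists_isMSG (F : CliqueGraph V) (P : Finset V) : ∃ U, F.IsMSG P U := by
  have key : ∀ n : ℕ, ∀ U : Finset (Finset V), U.card ≤ n →
      ∃ U', Relation.ReflTransGen (F.Prune P) U U' ∧ ∀ U'', ¬ F.Prune P U' U'' := by
    intro n
    induction n with
    | zero =>
      intro U hU
      refine ⟨U, .refl, ?_⟩
      rintro U'' ⟨A, hA, -⟩
      rw [Finset.card_eq_zero.1 (Nat.le_zero.1 hU)] at hA
      simp at hA
    | succ n ih =>
      intro U hU
      by_cases h : ∃ U'', F.Prune P U U''
      · obtain ⟨U'', h⟩ := h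
        obtain ⟨U', h₁, h₂⟩ := ih U'' (by
          obtain ⟨A, hA, _, _, _, _, _, rfl⟩ := h
          rw [Finset.card_erase_of_mem hA]
          omega)
        exact ⟨U', .head h h₁, h₂⟩
      · push Not at h
        exact ⟨U, .refl, h⟩
  exact key _ _ le_rfl

namespace IsMSG

/-- What holds before pruning and is preserved by pruning holds for minimal subgraphs. -/
theorem induction {p : Finset (Finset V) → Prop} (h : F.IsMSG P U)
    (base : p (F.hull (F.nodes.filter fun C => (C ∩ P).Nonempty)))
    (step : ∀ U U', F.Prune P U U' → p U → p U') : p U := by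
  have key : ∀ U', Relation.ReflTransGen (F.Prune P)
      (F.hull (F.nodes.filter fun C => (C ∩ P).Nonempty)) U' → p U' := by
    intro U' h
    induction h with
    | refl => exact base
    | tail _ h ih => exact step _ _ h ih
  exact key U h.1

theorem subset_nodes (h : F.IsMSG P U) : U ⊆ F.nodes := by
  refine h.induction (p := fun U => U ⊆ F.nodes) (F.hull_subset _) ?_
  rintro U _ ⟨A, _, _, _, _, _, _, rfl⟩ hU
  exact (Finset.erase_subset _ _).trans hU

theorem isPathConvex (h : F.IsMSG P U) (hF : F.IsForest) :
    F.graph.IsPathConvex (U : Set (Finset V)) := by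
  refine h.induction (p := fun U => F.graph.IsPathConvex (U : Set (Finset V)))
    (hF.isPathConvex_hull (Finset.filter_subset _ _)) ?_
  rintro U _ ⟨A, _, B, _, _, hAB, _, rfl⟩ hU
  rw [Finset.coe_erase]
  exact hU.diff_singleton hAB

theorem exists_mem (h : F.IsMSG P U) {x : V} (hx : x ∈ P) (hxF : x ∈ F.vars) :
    ∃ C ∈ U, x ∈ C := by
  refine h.induction (p := fun U => ∃ C ∈ U, x ∈ C) ?_ ?_
  · obtain ⟨C, hC, hxC⟩ := mem_vars.1 hxF
    exact ⟨C, subset_hull (Finset.filter_subset _ _)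
      (Finset.mem_filter.2 ⟨hC, x, Finset.mem_inter.2 ⟨hxC, hx⟩⟩), hxC⟩
  · rintro U _ ⟨A, hA, B, hB, hAB, _, hsub, rfl⟩ ⟨C, hC, hxC⟩
    by_cases hCA : C = A
    · subst hCA
      exact ⟨B, Finset.mem_erase.2 ⟨hAB.ne', hB⟩,
        (Finset.mem_inter.1 (hsub (Finset.mem_inter.2 ⟨hxC, hx⟩))).1⟩
    · exact ⟨C, Finset.mem_erase.2 ⟨hCA, hC⟩, hxC⟩

/-- A maximal clique that consists of variables in `P` is never pruned. -/
theorem mem_of_subset (h : F.IsMSG P U) (hF : F.IsCliqueForest) {C : Finset V} (hC : C ∈ F.nodes)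
    (hCP : C ⊆ P) : C ∈ U := by
  refine h.induction (p := fun U => C ∈ U) ?_ ?_
  · refine subset_hull (Finset.filter_subset _ _) (Finset.mem_filter.2 ⟨hC, ?_⟩)
    rw [Finset.inter_eq_left.2 hCP]
    exact hF.nonempty C hC
  · rintro U _ ⟨A, hA, B, hB, hAB, _, hsub, rfl⟩ hCU
    refine Finset.mem_erase.2 ⟨?_, hCU⟩
    rintro rfl
    rw [Finset.inter_eq_left.2 hCP] at hsub
    exact hAB.ne (hF.maximal C hC B (hF.edge_mem _ _ hAB).2
      (hsub.trans Finset.inter_subset_left))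

theorem eq_empty (h : F.IsMSG ∅ U) : U = ∅ := by
  classical
  refine h.induction (p := fun U => U = ∅) ?_ ?_
  · simp [hull]
  · rintro U _ ⟨A, hA, -⟩ rfl
    simp at hA

end IsMSG

/-! ### Attaching cliques -/

theorem mem_nodes_join {C : Finset V} :
    C ∈ (F.join U B).nodes ↔ C = B ∨ C ∈ F.nodes ∧ ¬ (C ∈ U ∧ C ⊆ B) := by
  simp [join]

theorem vars_join : (F.join U B).vars = F.vars ∪ B := by
  ext x
  simp only [mem_vars, mem_nodes_join, Finset.mem_union]
  constructor
  · rintro ⟨C, rfl | ⟨hC, -⟩, hx⟩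
    · exact Or.inr hx
    · exact Or.inl ⟨C, hC, hx⟩
  · rintro (⟨C, hC, hx⟩ | hx)
    · by_cases h : C ∈ U ∧ C ⊆ B
      · exact ⟨B, Or.inl rfl, h.2 hx⟩
      · exact ⟨C, Or.inr ⟨hC, h⟩, hx⟩
    · exact ⟨B, Or.inl rfl, hx⟩

theorem exists_subset_join {C : Finset V} (hC : C ∈ F.nodes) :
    ∃ C' ∈ (F.join U B).nodes, C ⊆ C' := by
  by_cases h : C ∈ U ∧ C ⊆ B
  · exact ⟨B, mem_nodes_join.2 (Or.inl rfl), h.2⟩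
  · exact ⟨C, mem_nodes_join.2 (Or.inr ⟨hC, h⟩), subset_rfl⟩

theorem not_mem_nodes_of_not_subset_vars (hB : ¬ B ⊆ F.vars) : B ∉ F.nodes :=
  fun h => hB fun _ hx => mem_vars.2 ⟨B, h, hx⟩

theorem IsCliqueForest.join (hF : F.IsCliqueForest) (hU : U ⊆ F.nodes)
    (hconv : F.graph.IsPathConvex (U : Set (Finset V))) (hdis : F.Disconnected U)
    (hB : ¬ B ⊆ F.vars) (hvars : ∀ x ∈ B, x ∈ F.vars → ∃ C ∈ U, x ∈ C)
    (hsub : ∀ A ∈ F.nodes, A ⊆ B → A ∈ U) : (F.join U B).IsCliqueForest where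
  toIsForest := hF.toIsForest.join hU hconv hdis (not_mem_nodes_of_not_subset_vars hB) hvars
  nonempty C hC := by
    rcases mem_nodes_join.1 hC with rfl | ⟨hC, -⟩
    · rw [Finset.nonempty_iff_ne_empty]
      rintro rfl
      exact hB (Finset.empty_subset _)
    · exact hF.nonempty C hC
  maximal X hX Y hY hXY := by
    rcases mem_nodes_join.1 hX with hXB | ⟨hXF, hX'⟩ <;>
      rcases mem_nodes_join.1 hY with hYB | ⟨hYF, -⟩
    · exact hXB.trans hYB.symm
    · exact (hB fun x hx => mem_vars.2 ⟨Y, hYF, hXY (hXB ▸ hx)⟩).elim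
    · rw [hYB] at hXY
      exact (hX' ⟨hsub X hXF hXY, hXY⟩).elim
    · exact hF.maximal X hXF Y hYF hXY

theorem IsCliqueForest.join_singleton (hF : F.IsCliqueForest) {C : Finset V} (hC : C ∈ F.nodes)
    (hB : ¬ B ⊆ F.vars) (hvars : ∀ x ∈ B, x ∈ F.vars → x ∈ C) :
    (F.join {C} B).IsCliqueForest := by
  refine hF.join (by simpa using hC) ?_ ?_ hB (fun x hx hxF => ⟨C, by simp, hvars x hx hxF⟩) ?_
  · intro X hX Y hY p hp Z hZ
    simp only [Finset.coe_singleton, Set.mem_singleton_iff] at hX hY ⊢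
    subst hX hY
    rw [SimpleGraph.Walk.nil_iff_support_eq.1 (SimpleGraph.Walk.isPath_iff_nil.1 hp)] at hZ
    simpa using hZ
  · intro X hX Y hY h
    simp only [Finset.mem_singleton] at hX hY
    exact h.ne (hX.trans hY.symm)
  · intro A hA hAB
    rw [Finset.mem_singleton]
    exact hF.maximal A hA C hC fun x hx => hvars x (hAB hx) (mem_vars.2 ⟨A, hA, hx⟩)

namespace Attach

variable {α : Type*} [DecidableEq α] {D key : α → Finset V} {I : Finset α}

theorem exists_subset (h : Attach D key I F F') : ∀ C ∈ F.nodes, ∃ C' ∈ F'.nodes, C ⊆ C' := by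
  induction h with
  | done F => exact fun C hC => ⟨C, hC, subset_rfl⟩
  | step i C₀ hi hC₀ hkey h ih =>
    intro C hC
    obtain ⟨C', hC', h₁⟩ := exists_subset_join (U := {C₀}) (B := D i) hC
    obtain ⟨C'', hC'', h₂⟩ := ih C' hC'
    exact ⟨C'', hC'', h₁.trans h₂⟩

theorem vars_eq (h : Attach D key I F F') : F'.vars = F.vars ∪ I.biUnion D := by
  induction h with
  | done F => simp
  | step i C₀ hi hC₀ hkey h ih =>
    rw [ih, vars_join, Finset.union_assoc, ← Finset.biUnion_insert, Finset.insert_erase hi]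

theorem mem_nodes (h : Attach D key I F F') : ∀ C ∈ F'.nodes, C ∈ F.nodes ∨ ∃ i ∈ I, C = D i := by
  induction h with
  | done F => exact fun C hC => Or.inl hC
  | step i C₀ hi hC₀ hkey h ih =>
    intro C hC
    rcases ih C hC with hC | ⟨j, hj, rfl⟩
    · rcases mem_nodes_join.1 hC with rfl | ⟨hC, -⟩
      · exact Or.inr ⟨i, hi, rfl⟩
      · exact Or.inl hC
    · exact Or.inr ⟨j, Finset.mem_of_mem_erase hj, rfl⟩

/-- A clique remains in the graph unless an attached clique absorbs it. -/
theorem mem_of_not_subset (h : Attach D key I F F') :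
    ∀ C ∈ F.nodes, (∀ i ∈ I, ¬ C ⊆ D i) → C ∈ F'.nodes := by
  induction h with
  | done F => exact fun C hC _ => hC
  | step i C₀ hi hC₀ hkey h ih =>
    intro C hC hCD
    exact ih C (mem_nodes_join.2 (Or.inr ⟨hC, fun h => hCD i hi h.2⟩))
      fun j hj => hCD j (Finset.mem_of_mem_erase hj)

theorem attached_mem (h : Attach D key I F F')
    (hD : ∀ i ∈ I, ∀ j ∈ I, j ≠ i → ¬ D i ⊆ D j) : ∀ i ∈ I, D i ∈ F'.nodes := by
  induction h with
  | done F => simp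
  | @step I F F' i C₀ hi hC₀ hkey h ih =>
    intro j hj
    by_cases hji : j = i
    · subst hji
      exact h.mem_of_not_subset _ (mem_nodes_join.2 (Or.inl rfl)) fun k hk =>
        hD j hj k (Finset.mem_of_mem_erase hk) (Finset.ne_of_mem_erase hk)
    · exact ih (fun a ha b hb => hD a (Finset.mem_of_mem_erase ha) b (Finset.mem_of_mem_erase hb))
        j (Finset.mem_erase.2 ⟨hji, hj⟩)

/-- Attaching preserves clique forests if each attached clique has a variable of its own, and
shares with the rest only variables in its key. -/
theorem isCliqueForest (h : Attach D key I F F') (hF : F.IsCliqueForest)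
    (hown : ∀ i ∈ I, ∃ x ∈ D i, x ∉ F.vars ∧ ∀ j ∈ I, j ≠ i → x ∉ D j)
    (hshare : ∀ i ∈ I, ∀ x ∈ D i, (x ∈ F.vars ∨ ∃ j ∈ I, j ≠ i ∧ x ∈ D j) → x ∈ key i) :
    F'.IsCliqueForest := by
  induction h with
  | done F => exact hF
  | @step I F F' i C hi hC hkey h ih =>
    refine ih (IsCliqueForest.join_singleton hF hC ?_ ?_) ?_ ?_
    · obtain ⟨x, hx, hxF, -⟩ := hown i hi
      exact fun h => hxF (h hx)
    · exact fun x hx hxF => hkey (hshare i hi x hx (Or.inl hxF))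
    · intro j hj
      obtain ⟨hji, hj⟩ := Finset.mem_erase.1 hj
      obtain ⟨x, hx, hxF, hx'⟩ := hown j hj
      refine ⟨x, hx, ?_, fun k hk => hx' k (Finset.mem_of_mem_erase hk)⟩
      rw [vars_join, Finset.mem_union, not_or]
      exact ⟨hxF, hx' i hi hji.symm⟩
    · intro j hj x hx hx'
      obtain ⟨hji, hj⟩ := Finset.mem_erase.1 hj
      refine hshare j hj x hx ?_
      rw [vars_join, Finset.mem_union] at hx'
      rcases hx' with (h | h) | ⟨k, hk, hkj, h⟩
      · exact Or.inl h
      · exact Or.inr ⟨i, hi, hji.symm, h⟩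
      · exact Or.inr ⟨k, Finset.mem_of_mem_erase hk, hkj, h⟩

theorem exists_of_exists_key (D key : α → Finset V) (I : Finset α) :
    ∀ F : CliqueGraph V, (∀ i ∈ I, ∃ C ∈ F.nodes, key i ⊆ C) → ∃ F', Attach D key I F F' := by
  induction I using Finset.induction_on with
  | empty => exact fun F _ => ⟨F, .done F⟩
  | insert i I hi ih =>
    intro F hF
    obtain ⟨C, hC, hkey⟩ := hF i (Finset.mem_insert_self _ _)
    obtain ⟨F', hF'⟩ := ih (F.join {C} (D i)) fun j hj => by
      obtain ⟨C₁, hC₁, h₁⟩ := hF j (Finset.mem_insert_of_mem hj)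
      obtain ⟨C₂, hC₂, h₂⟩ := exists_subset_join (U := {C}) (B := D i) hC₁
      exact ⟨C₂, hC₂, h₁.trans h₂⟩
    refine ⟨F', .step i C (Finset.mem_insert_self _ _) hC hkey ?_⟩
    rwa [Finset.erase_insert hi]

end Attach

end CliqueGraph

/-! ### The modified subtree -/

/-- A graph that is complete on `S` and has no other edges is chordal: a start vertex of a cycle has
only two neighbours along it, and with a third vertex it forms a chord. -/
theorem SimpleGraph.isChordalGraph_of_complete {V : Type*} {H : SimpleGraph V} {S : Set V}
    (hH : ∀ x y, H.Adj x y ↔ x ≠ y ∧ x ∈ S ∧ y ∈ S) : H.IsChordalGraph := by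
  classical
  intro v c hc hlen
  have hS : ∀ x ∈ c.support, x ∈ S := by
    intro x hx
    obtain ⟨e, he, hxe⟩ := (SimpleGraph.Walk.mem_support_iff_exists_mem_edges_of_not_nil
      hc.not_nil).1 hx
    obtain ⟨y, rfl⟩ := hxe
    exact ((hH x y).1 (c.edges_subset_edgeSet he)).2.1
  have hcard : 4 ≤ c.support.tail.toFinset.card := by
    rw [List.toFinset_card_of_nodup hc.support_nodup]
    simpa using hlen
  have h₂ := hc.ncard_neighborSet_toSubgraph_eq_two c.start_mem_support
  -- `v` and its two neighbours on the cycle do not exhaust the at least four vertices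
  obtain ⟨y, hy, hy'⟩ : ∃ y ∈ c.support.tail.toFinset,
      y ∉ insert v (c.toSubgraph.neighborSet v) := by
    by_contra! hcon
    have hle : (c.support.tail.toFinset : Set V).ncard ≤ _ :=
      Set.ncard_le_ncard hcon (Set.Finite.insert _ (Set.finite_of_ncard_ne_zero (by omega)))
    have := Set.ncard_insert_le v (c.toSubgraph.neighborSet v)
    rw [Set.ncard_coe_finset] at hle
    omega
  have hys : y ∈ c.support := List.mem_of_mem_tail (List.mem_toFinset.1 hy)
  rw [Set.mem_insert_iff, not_or] at hy'
  refine ⟨v, c.start_mem_support, y, hys,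
    (hH _ _).2 ⟨Ne.symm hy'.1, hS v c.start_mem_support, hS y hys⟩, fun he => hy'.2 ?_⟩
  rw [SimpleGraph.Subgraph.mem_neighborSet, ← SimpleGraph.Subgraph.mem_edgeSet]
  simpa using he

namespace BayesNet

section

variable {V : Type*} {D : V → Type*} [DecidableEq V] [∀ v, Fintype (D v)] {net : BayesNet V D}
  {F : CliqueGraph V} {g : Finset V} {U : Finset (Finset V)} {x : V}

theorem mem_family {v : V} : x ∈ net.family v ↔ x = v ∨ x ∈ net.parents v := by
  simp [family]

/-- The new variables `g`, whose parents are already present, can be added to the part `U` of the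
forest, which is path-convex and contains all their parents. -/
structure IsAddable (net : BayesNet V D) (F : CliqueGraph V) (g : Finset V)
    (U : Finset (Finset V)) : Prop where
  not_mem_vars : ∀ v ∈ g, v ∉ F.vars
  subset_nodes : U ⊆ F.nodes
  isPathConvex : F.graph.IsPathConvex (U : Set (Finset V))
  covers : ∀ v ∈ g, ∀ x ∈ net.parents v, ∃ C ∈ U, x ∈ C

theorem IsGroupMSG.isAddable (h : net.IsGroupMSG F g U) (hF : F.IsForest)
    (hg : ∀ v ∈ g, v ∉ F.vars) (hpar : ∀ v ∈ g, net.parents v ⊆ F.vars) :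
    net.IsAddable F g U := by
  obtain ⟨m, hm, rfl⟩ := h
  have hsub : g.biUnion m ⊆ F.nodes := by
    rw [Finset.biUnion_subset]
    exact fun v hv => (hm v hv).subset_nodes
  refine ⟨hg, F.hull_subset _, hF.isPathConvex_hull hsub, fun v hv x hx => ?_⟩
  obtain ⟨C, hC, hxC⟩ := (hm v hv).exists_mem hx (hpar v hv hx)
  exact ⟨C, CliqueGraph.subset_hull hsub (Finset.mem_biUnion.2 ⟨v, hv, hC⟩), hxC⟩

theorem IsAddable.not_mem_of_mem_nodes (h : net.IsAddable F g U) {C : Finset V} (hC : C ∈ F.nodes)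
    (hx : x ∈ C) : x ∉ g :=
  fun hxg => h.not_mem_vars x hxg (CliqueGraph.mem_vars.2 ⟨C, hC, hx⟩)

theorem IsAddable.not_mem_parents (h : net.IsAddable F g U) {v : V} (hv : v ∈ g) (hx : x ∈ g) :
    x ∉ net.parents v := by
  intro hxv
  obtain ⟨C, hC, hxC⟩ := h.covers v hv x hxv
  exact h.not_mem_of_mem_nodes (h.subset_nodes hC) hxC hx

end

variable {V : Type*} {D : V → Type*} [Fintype V] [DecidableEq V] [∀ v, Fintype (D v)]
  {net : BayesNet V D} {F ST : CliqueGraph V} {g : Finset V} {U : Finset (Finset V)} {x : V}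

theorem mem_elimVars : x ∈ net.elimVars F g U ↔ (∃ v ∈ g, x ∈ net.parents v) ∨
    ∃ A ∈ U, ∃ B ∈ U, F.graph.Adj A B ∧ x ∈ A ∩ B := by
  simp [elimVars]

theorem mem_retained {C : Finset V} :
    C ∈ net.retained F g U ↔ C ∈ U ∧ ¬ C ⊆ net.elimVars F g U := by
  simp [retained]

/-- `ST` can take the place of `U`: it is a clique forest on the variables of `U` and `g`, it has
room for all the factors and for all the edges from outside, and none of its cliques is comparable
with a clique outside `U`. -/
structure IsFitting (net : BayesNet V D) (F : CliqueGraph V) (g : Finset V)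
    (U : Finset (Finset V)) (ST : CliqueGraph V) : Prop where
  isCliqueForest : ST.IsCliqueForest
  mem_vars : ∀ x, x ∈ ST.vars ↔ (∃ C ∈ U, x ∈ C) ∨ x ∈ g
  exists_subset : ∀ C ∈ U, ∃ C' ∈ ST.nodes, C ⊆ C'
  retained_subset : net.retained F g U ⊆ ST.nodes
  family_mem : ∀ v ∈ g, net.family v ∈ ST.nodes
  not_subset : ∀ A ∈ F.nodes, A ∉ U → ∀ C ∈ ST.nodes, ¬ A ⊆ C
  not_superset : ∀ A ∈ F.nodes, A ∉ U → ∀ C ∈ ST.nodes, ¬ C ⊆ A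

namespace IsAddable

theorem elimVars_covered (h : net.IsAddable F g U) (hx : x ∈ net.elimVars F g U) :
    ∃ C ∈ U, x ∈ C := by
  rcases mem_elimVars.1 hx with ⟨v, hv, hx⟩ | ⟨A, hA, _, _, _, hx⟩
  · exact h.covers v hv x hx
  · exact ⟨A, hA, (Finset.mem_inter.1 hx).1⟩

/-- A variable shared by two cliques in `U` is in a sepset. -/
theorem mem_elimVars_of_mem (h : net.IsAddable F g U) (hF : F.IsForest) {C C' : Finset V}
    (hC : C ∈ U) (hC' : C' ∈ U) (hne : C ≠ C') (hx : x ∈ C) (hx' : x ∈ C') :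
    x ∈ net.elimVars F g U := by
  classical
  obtain ⟨⟨p⟩, hp⟩ := hF.running x C (h.subset_nodes hC) C' (h.subset_nodes hC') hx hx'
  have h₁ := hp _ p.toPath.2
  have h₂ := h.isPathConvex C hC C' hC' _ p.toPath.2
  generalize (p.toPath : F.graph.Walk C C') = q at h₁ h₂
  cases q with
  | nil => exact (hne rfl).elim
  | @cons _ Z _ hadj q =>
    exact mem_elimVars.2 (Or.inr ⟨C, hC, Z, h₂ Z (by simp), hadj,
      Finset.mem_inter.2 ⟨hx, h₁ Z (by simp)⟩⟩)

/-- The modified subtree can take the place of `U`. A new clique has its variable to itself, and a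
retained clique its variables outside `S`, so that attaching them preserves clique forests. -/
theorem isFitting (h : net.IsAddable F g U) (hF : F.IsCliqueForest)
    (hST : net.IsModifiedSubtree F g U ST) : net.IsFitting F g U ST := by
  obtain ⟨H, ST₀, ST₁, hle, -, -, htree, hatt₁, hatt₂⟩ := hST
  set S := net.elimVars F g U with hS
  -- the maximal cliques of the triangulated graph
  have hclique : ∀ K : Finset V, K.Nonempty → K ⊆ S → H.IsClique (K : Set V) →
      ∃ C ∈ ST₀.nodes, K ⊆ C := by
    intro K h₁ h₂ h₃
    obtain ⟨C, hKC, hC⟩ := Set.Finite.exists_le_maximal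
      (s := {L : Finset V | L.Nonempty ∧ L ⊆ S ∧ H.IsClique (L : Set V)}) (Set.toFinite _)
      (a := K) ⟨h₁, h₂, h₃⟩
    exact ⟨C, (htree.mem_nodes C).2 hC, hKC⟩
  have hU_clique : ∀ C ∈ U, H.IsClique ((C ∩ S : Finset V) : Set V) := by
    intro C hC x hx y hy hne
    exact hle ((SimpleGraph.fromRel_adj _ _ _).2 ⟨hne, Or.inl (Or.inl ⟨C, hC, hx, hy⟩)⟩)
  have hST₀ : ST₀.IsCliqueForest := by
    refine ⟨htree.isForest, fun C hC => ((htree.mem_nodes C).1 hC).1.1, fun A hA B hB hAB => ?_⟩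
    exact hAB.antisymm (((htree.mem_nodes A).1 hA).2 ((htree.mem_nodes B).1 hB).1 hAB)
  have hvars₀ : ∀ x, x ∈ ST₀.vars ↔ x ∈ S := by
    intro x
    constructor
    · intro hx
      obtain ⟨C, hC, hxC⟩ := CliqueGraph.mem_vars.1 hx
      exact ((htree.mem_nodes C).1 hC).1.2.1 hxC
    · intro hx
      obtain ⟨C, hC, hxC⟩ := hclique {x} (Finset.singleton_nonempty x) (by simpa using hx)
        (by simp)
      exact CliqueGraph.mem_vars.2 ⟨C, hC, hxC (Finset.mem_singleton_self x)⟩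
  have hSg : ∀ x ∈ S, x ∉ g := by
    intro x hx
    obtain ⟨C, hC, hxC⟩ := h.elimVars_covered hx
    exact h.not_mem_of_mem_nodes (h.subset_nodes hC) hxC
  have hpar : ∀ v ∈ g, net.parents v ⊆ S := fun v hv x hx => mem_elimVars.2 (Or.inl ⟨v, hv, hx⟩)
  have hself : ∀ v, v ∈ net.family v := fun v => mem_family.2 (Or.inl rfl)
  have hfam : ∀ v ∈ g, ∀ w ∈ g, w ≠ v → v ∉ net.family w := by
    intro v hv w hw hne hvw
    rcases mem_family.1 hvw with h' | h'
    · exact hne h'.symm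
    · exact h.not_mem_parents hw hv h'
  have hST₁ : ST₁.IsCliqueForest := by
    refine hatt₁.isCliqueForest hST₀ ?_ ?_
    · exact fun v hv => ⟨v, hself v, fun hv' => hSg v ((hvars₀ v).1 hv') hv, hfam v hv⟩
    · rintro v hv x hx hx'
      rcases mem_family.1 hx with rfl | hx
      · rcases hx' with hx' | ⟨w, hw, hne, hx'⟩
        · exact (hSg x ((hvars₀ x).1 hx') hv).elim
        · exact (hfam x hv w hw hne hx').elim
      · exact hx
  have hvars₁ : ∀ x, x ∈ ST₁.vars ↔ x ∈ S ∨ x ∈ g := by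
    intro x
    rw [hatt₁.vars_eq, Finset.mem_union, hvars₀, Finset.mem_biUnion]
    constructor
    · rintro (hx | ⟨v, hv, hx⟩)
      · exact Or.inl hx
      · rcases mem_family.1 hx with rfl | hx
        · exact Or.inr hv
        · exact Or.inl (hpar v hv hx)
    · rintro (hx | hx)
      · exact Or.inl hx
      · exact Or.inr ⟨x, hx, hself x⟩
  have hUg : ∀ C ∈ U, ∀ x ∈ C, x ∉ g := fun C hC x hx =>
    h.not_mem_of_mem_nodes (h.subset_nodes hC) hx
  have hshared : ∀ C ∈ net.retained F g U, ∀ C' ∈ net.retained F g U, C' ≠ C → ∀ x ∈ C, x ∈ C' →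
      x ∈ S := fun C hC C' hC' hne x hx hx' =>
    h.mem_elimVars_of_mem hF.toIsForest (mem_retained.1 hC).1 (mem_retained.1 hC').1 hne.symm hx hx'
  have hfor : ST.IsCliqueForest := by
    refine hatt₂.isCliqueForest hST₁ ?_ ?_
    · intro C hC
      obtain ⟨hCU, hCS⟩ := mem_retained.1 hC
      obtain ⟨x, hxC, hxS⟩ := Finset.not_subset.1 hCS
      refine ⟨x, hxC, ?_, fun C' hC' hne hx' => hxS (hshared C hC C' hC' hne x hxC hx')⟩
      rw [hvars₁, not_or]
      exact ⟨hxS, hUg C hCU x hxC⟩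
    · rintro C hC x hx hx'
      refine Finset.mem_inter.2 ⟨hx, ?_⟩
      rcases hx' with hx' | ⟨C', hC', hne, hx'⟩
      · exact ((hvars₁ x).1 hx').resolve_right (hUg C (mem_retained.1 hC).1 x hx)
      · exact hshared C hC C' hC' hne x hx hx'
  have hret : net.retained F g U ⊆ ST.nodes := by
    refine hatt₂.attached_mem fun C hC C' hC' hne hsub => hne ?_
    exact (hF.maximal C (h.subset_nodes (mem_retained.1 hC).1) C'
      (h.subset_nodes (mem_retained.1 hC').1) hsub).symm
  have hcover : ∀ C ∈ U, ∃ C' ∈ ST.nodes, C ⊆ C' := by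
    intro C hC
    by_cases hCS : C ⊆ S
    · obtain ⟨C₀, hC₀, h₀⟩ := hclique C (hF.nonempty C (h.subset_nodes hC)) hCS
        (by simpa [Finset.inter_eq_left.2 hCS] using hU_clique C hC)
      obtain ⟨C₁, hC₁, h₁⟩ := hatt₁.exists_subset C₀ hC₀
      obtain ⟨C₂, hC₂, h₂⟩ := hatt₂.exists_subset C₁ hC₁
      exact ⟨C₂, hC₂, h₀.trans (h₁.trans h₂)⟩
    · exact ⟨C, hret (mem_retained.2 ⟨hC, hCS⟩), subset_rfl⟩
  have hvars : ∀ x, x ∈ ST.vars ↔ (∃ C ∈ U, x ∈ C) ∨ x ∈ g := by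
    intro x
    rw [hatt₂.vars_eq, Finset.mem_union, hvars₁, Finset.mem_biUnion]
    constructor
    · rintro ((hx | hx) | ⟨C, hC, hx⟩)
      · exact Or.inl (h.elimVars_covered hx)
      · exact Or.inr hx
      · exact Or.inl ⟨C, (mem_retained.1 hC).1, hx⟩
    · rintro (⟨C, hC, hx⟩ | hx)
      · by_cases hxS : x ∈ S
        · exact Or.inl (Or.inl hxS)
        · exact Or.inr ⟨C, mem_retained.2 ⟨hC, fun h' => hxS (h' hx)⟩, hx⟩
      · exact Or.inl (Or.inr hx)
  refine ⟨hfor, hvars, hcover, hret, ?_, ?_, ?_⟩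
  · intro v hv
    refine hatt₂.mem_of_not_subset _ (hatt₁.attached_mem ?_ v hv) ?_
    · exact fun v hv w hw hne hsub => hfam v hv w hw hne (hsub (hself v))
    · exact fun C hC hsub => hUg C (mem_retained.1 hC).1 v (hsub (hself v)) hv
  · intro A hA hAU C hC hAC
    have hAv : ∀ x ∈ A, ∃ C ∈ U, x ∈ C := fun x hx =>
      ((hvars x).1 (CliqueGraph.mem_vars.2 ⟨C, hC, hAC hx⟩)).resolve_right
        (h.not_mem_of_mem_nodes hA hx)
    obtain ⟨x, hx⟩ := hF.nonempty A hA
    obtain ⟨C', hC', hx'⟩ := hAv x hx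
    obtain ⟨B, hB, hAB⟩ := hF.exists_inter_subset h.isPathConvex h.subset_nodes hA hC' hx hx'
    exact hAU (hF.maximal A hA B (h.subset_nodes hB) (fun y hy => hAB y hy (hAv y hy)) ▸ hB)
  · intro A hA hAU C hC hCA
    -- `C` is a clique of the triangulated graph: the others contain variables outside `A`
    have hC₀ : C ∈ ST₀.nodes := by
      rcases hatt₂.mem_nodes C hC with hC₁ | ⟨C', hC', rfl⟩
      · rcases hatt₁.mem_nodes C hC₁ with hC₀ | ⟨v, hv, rfl⟩
        · exact hC₀
        · exact (h.not_mem_of_mem_nodes hA (hCA (hself v)) hv).elim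
      · have hCU := (mem_retained.1 hC').1
        exact (hAU (hF.maximal _ (h.subset_nodes hCU) A hA hCA ▸ hCU)).elim
    have hCmax := (htree.mem_nodes C).1 hC₀
    have hCS := hCmax.1.2.1
    have hCv : ∀ x ∈ C, ∃ C ∈ U, x ∈ C := fun x hx => h.elimVars_covered (hCS hx)
    obtain ⟨x, hx⟩ := hCmax.1.1
    obtain ⟨C', hC', hx'⟩ := hCv x hx
    obtain ⟨B, hB, hAB⟩ :=
      hF.exists_inter_subset h.isPathConvex h.subset_nodes hA hC' (hCA hx) hx'
    have hCB : C ⊆ B := fun y hy => hAB y (hCA hy) (hCv y hy)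
    have hBC : B ∩ S ⊆ C := hCmax.2 ⟨⟨x, Finset.mem_inter.2 ⟨hCB hx, hCS hx⟩⟩,
      Finset.inter_subset_right, hU_clique B hB⟩ (Finset.subset_inter hCB hCS)
    have hBA : B ≠ A := fun h' => hAU (h' ▸ hB)
    -- by maximality `C = B ∩ S`: compare `C` with `A` if `B` is not retained, and else with `B`
    by_cases hBS : B ⊆ S
    · rw [Finset.inter_eq_left.2 hBS] at hBC
      exact hBA (hF.maximal B (h.subset_nodes hB) A hA (hBC.trans hCA))
    · exact hBS ((hfor.maximal C hC B (hret (mem_retained.2 ⟨hB, hBS⟩)) hCB) ▸ hCS)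

end IsAddable

/-- The elimination graph can be triangulated by making `S` complete, with `S` as the only clique of
the clique tree. This needs `S` to be non-empty. -/
theorem exists_isModifiedSubtree (net : BayesNet V D) (F : CliqueGraph V) {g : Finset V}
    (U : Finset (Finset V)) (hg : ∃ v ∈ g, (net.parents v).Nonempty) :
    ∃ ST, net.IsModifiedSubtree F g U ST := by
  set S := net.elimVars F g U with hS
  have hSne : S.Nonempty := by
    obtain ⟨v, hv, x, hx⟩ := hg
    exact ⟨x, mem_elimVars.2 (Or.inl ⟨v, hv, hx⟩)⟩
  let H : SimpleGraph V := SimpleGraph.fromRel fun x y => x ∈ S ∧ y ∈ S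
  have hH : ∀ x y, H.Adj x y ↔ x ≠ y ∧ x ∈ S ∧ y ∈ S := by
    intro x y
    simp only [H, SimpleGraph.fromRel_adj]
    tauto
  have hparS : ∀ v ∈ g, net.parents v ⊆ S := fun v hv x hx => mem_elimVars.2 (Or.inl ⟨v, hv, hx⟩)
  obtain ⟨ST₁, h₁⟩ := CliqueGraph.Attach.exists_of_exists_key net.family net.parents g
    (CliqueGraph.star S ∅) fun v hv => ⟨S, by simp [CliqueGraph.star], hparS v hv⟩
  obtain ⟨C₁, hC₁, hSC₁⟩ := h₁.exists_subset S (by simp [CliqueGraph.star])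
  obtain ⟨ST, h₂⟩ := CliqueGraph.Attach.exists_of_exists_key (fun C => C) (fun C => C ∩ S)
    (net.retained F g U) ST₁ fun C _ => ⟨C₁, hC₁, Finset.inter_subset_right.trans hSC₁⟩
  refine ⟨ST, H, CliqueGraph.star S ∅, ST₁, ?_, fun x y h => ((hH x y).1 h).2,
    SimpleGraph.isChordalGraph_of_complete (S := S) hH, ⟨?_, ?_⟩, h₁, h₂⟩
  · intro x y h
    rw [elimGraph, SimpleGraph.fromRel_adj] at h
    refine (hH x y).2 ⟨h.1, ?_⟩
    rcases h.2 with (⟨C, _, hx, hy⟩ | ⟨v, hv, hx, hy⟩) | ⟨C, _, hx, hy⟩ | ⟨v, hv, hx, hy⟩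
    · exact ⟨(Finset.mem_inter.1 hx).2, (Finset.mem_inter.1 hy).2⟩
    · exact ⟨hparS v hv hx, hparS v hv hy⟩
    · exact ⟨(Finset.mem_inter.1 hy).2, (Finset.mem_inter.1 hx).2⟩
    · exact ⟨hparS v hv hy, hparS v hv hx⟩
  · have hprop : S.Nonempty ∧ S ⊆ S ∧ H.IsClique (S : Set V) :=
      ⟨hSne, subset_rfl, fun x hx y hy hne => (hH x y).2 ⟨hne, hx, hy⟩⟩
    intro K
    simp only [CliqueGraph.star, insert_empty_eq, Finset.mem_singleton]
    constructor
    · rintro rfl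
      exact ⟨hprop, fun L hL _ => hL.2.1⟩
    · exact fun hK => hK.1.2.1.antisymm (hK.2 hprop hK.1.2.1)
  · exact CliqueGraph.isForest_star (by simp) (by simp)

end BayesNet

/-! ### Validity is preserved when variables are added -/

section

variable {V : Type*} {D : V → Type*} {J : Type*} [DecidableEq V] [∀ v, Fintype (D v)]
  {net : BayesNet V D} {ψ : J → Factor V D} {T : CTF V J} {Q : ((v : V) → D v) → ℝ}

theorem CTF.IsValid.isCliqueForest (h : T.IsValid net ψ Q) : T.toCliqueGraph.IsCliqueForest :=
  ⟨⟨h.edge_mem, h.acyclic, h.running⟩, h.nonempty, h.maximal⟩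

theorem CTF.IsValid.not_mem_factors (h : T.IsValid net ψ Q) {v : V} (hv : v ∉ T.vars) :
    Sum.inr v ∉ T.factors := fun hmem =>
  hv (CliqueGraph.mem_vars.2 ⟨_, (h.assigned _ hmem).1,
    (h.assigned _ hmem).2 (BayesNet.mem_family.2 (Or.inl rfl))⟩)

/-- The joint distribution of a valid clique tree forest is a function of its variables. -/
theorem CTF.IsValid.dependsOn (h : T.IsValid net ψ Q) : DependsOn Q (T.vars : Set V) := by
  intro x y hxy
  rw [← h.product, ← h.product]
  refine Finset.prod_congr rfl fun i hi => (net.factor ψ i).dependsOn fun v hv => ?_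
  exact hxy v (CliqueGraph.mem_vars.2 ⟨_, (h.assigned i hi).1, (h.assigned i hi).2 hv⟩)

end

namespace BayesNet

variable {V : Type*} {D : V → Type*} {J : Type*} [DecidableEq V] [DecidableEq J]
  [∀ v, Fintype (D v)] {net : BayesNet V D} {ψ : J → Factor V D} {T T' : CTF V J} {g : Finset V}
  {U : Finset (Finset V)} {ST : CliqueGraph V} {Q : ((v : V) → D v) → ℝ}

theorem vars_addSimple {v : V} (hpar : net.parents v ⊆ T.vars) :
    (net.addSimple T U v).vars = insert v T.vars := by
  have : (net.addSimple T U v).vars = (T.toCliqueGraph.join U (net.family v)).vars := rfl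
  rw [this, CliqueGraph.vars_join, family, Finset.union_insert, Finset.union_eq_left.2 hpar]

theorem isValid_addSimple {v : V} (hT : T.IsValid net ψ Q) (hv : v ∉ T.vars)
    (hpar : net.parents v ⊆ T.vars) (hU : T.IsMSG (net.parents v) U) (hdis : T.Disconnected U) :
    (net.addSimple T U v).IsValid net ψ (fun x => Q x * net.cpd v x) := by
  classical
  have hF := hT.isCliqueForest
  have hforest : (T.toCliqueGraph.join U (net.family v)).IsCliqueForest := by
    refine hF.join hU.subset_nodes (hU.isPathConvex hF.toIsForest) hdis
      (fun h => hv (h (mem_family.2 (Or.inl rfl)))) ?_ ?_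
    · intro x hx hxT
      rcases mem_family.1 hx with rfl | hx
      · exact (hv hxT).elim
      · exact hU.exists_mem hx hxT
    · intro A hA hAv
      refine hU.mem_of_subset hF hA fun x hx => (mem_family.1 (hAv hx)).resolve_left ?_
      rintro rfl
      exact hv (CliqueGraph.mem_vars.2 ⟨A, hA, hx⟩)
  have hfac := hT.not_mem_factors hv
  refine ⟨hforest.edge_mem, hforest.acyclic, hforest.nonempty, hforest.maximal, hforest.running,
    ?_, ?_⟩
  · intro i hi
    have hmem : ∀ C, C ∈ (net.addSimple T U v).nodes ↔
        C = net.family v ∨ C ∈ T.nodes ∧ ¬ (C ∈ U ∧ C ⊆ net.family v) :=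
      fun C => CliqueGraph.mem_nodes_join
    have hhost : (net.addSimple T U v).host i = if i = Sum.inr v then net.family v
      else if T.host i ∈ U ∧ T.host i ⊆ net.family v then net.family v else T.host i := by
      simp only [addSimple]
    rw [hmem, hhost]
    rcases Finset.mem_insert.1 hi with rfl | hi
    · rw [if_pos rfl]
      exact ⟨Or.inl rfl, subset_rfl⟩
    · rw [if_neg (by rintro rfl; exact hfac hi)]
      obtain ⟨h₁, h₂⟩ := hT.assigned i hi
      split_ifs with h
      · exact ⟨Or.inl rfl, h₂.trans h.2⟩
      · exact ⟨Or.inr ⟨h₁, h⟩, h₂⟩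
  · intro x
    simp only [addSimple]
    rw [Finset.prod_insert hfac, hT.product, mul_comm]
    rfl

variable [Fintype V]

namespace IsReplacement

theorem vars_eq (h : net.IsReplacement ψ T g U ST T')
    (hadd : net.IsAddable T.toCliqueGraph g U) (hfit : net.IsFitting T.toCliqueGraph g U ST) :
    T'.vars = T.vars ∪ g := by
  obtain ⟨gate, -, hnodes, -⟩ := h
  ext x
  rw [Finset.mem_union, CliqueGraph.mem_vars, CliqueGraph.mem_vars, hnodes]
  have hST := hfit.mem_vars x
  rw [CliqueGraph.mem_vars] at hST
  constructor
  · rintro ⟨C, hC, hx⟩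
    rcases Finset.mem_union.1 hC with hC | hC
    · exact Or.inl ⟨C, (Finset.mem_sdiff.1 hC).1, hx⟩
    · rcases hST.1 ⟨C, hC, hx⟩ with ⟨B, hB, hx⟩ | hx
      · exact Or.inl ⟨B, hadd.subset_nodes hB, hx⟩
      · exact Or.inr hx
  · rintro (⟨C, hC, hx⟩ | hx)
    · by_cases hCU : C ∈ U
      · obtain ⟨B, hB, hx⟩ := hST.2 (Or.inl ⟨C, hCU, hx⟩)
        exact ⟨B, Finset.mem_union_right _ hB, hx⟩
      · exact ⟨C, Finset.mem_union_left _ (Finset.mem_sdiff.2 ⟨hC, hCU⟩), hx⟩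
    · obtain ⟨B, hB, hx⟩ := hST.2 (Or.inr hx)
      exact ⟨B, Finset.mem_union_right _ hB, hx⟩

theorem isValid (h : net.IsReplacement ψ T g U ST T') (hT : T.IsValid net ψ Q)
    (hadd : net.IsAddable T.toCliqueGraph g U) (hfit : net.IsFitting T.toCliqueGraph g U ST) :
    T'.IsValid net ψ (fun x => Q x * ∏ v ∈ g, net.cpd v x) := by
  have hF := hT.isCliqueForest
  have hSTF := hfit.isCliqueForest
  obtain ⟨gate, hgate, hnodes, hgraph, hfac, hhost_new, hhost_keep, hhost_move⟩ := h
  have hforest : T'.toCliqueGraph.IsForest := by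
    refine hF.replace hSTF.toIsForest hadd.subset_nodes hadd.isPathConvex gate hgate hnodes hgraph
      (fun A hA hAU hA' => hfit.not_subset A hA hAU A hA' subset_rfl) fun x hx hxT => ?_
    exact ((hfit.mem_vars x).1 hx).resolve_right fun hxg => hadd.not_mem_vars x hxg hxT
  have hmem : ∀ C, C ∈ T'.nodes ↔ (C ∈ T.nodes ∧ C ∉ U) ∨ C ∈ ST.nodes := by
    simp [hnodes]
  have hnew : ∀ v ∈ g, Sum.inr v ∉ T.factors :=
    fun v hv => hT.not_mem_factors (hadd.not_mem_vars v hv)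
  refine ⟨hforest.edge_mem, hforest.acyclic, ?_, ?_, hforest.running, ?_, ?_⟩
  · intro C hC
    rcases (hmem C).1 hC with hC | hC
    · exact hT.nonempty C hC.1
    · exact hSTF.nonempty C hC
  · intro A hA B hB hAB
    rcases (hmem A).1 hA with ⟨hA, hAU⟩ | hA <;> rcases (hmem B).1 hB with ⟨hB, hBU⟩ | hB
    · exact hT.maximal A hA B hB hAB
    · exact (hfit.not_subset A hA hAU B hB hAB).elim
    · exact (hfit.not_superset B hB hBU A hA hAB).elim
    · exact hSTF.maximal A hA B hB hAB
  · intro i hi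
    rw [hfac, Finset.mem_union, Finset.mem_image] at hi
    rw [hmem]
    rcases hi with hi | ⟨v, hv, rfl⟩
    · obtain ⟨h₁, h₂⟩ := hT.assigned i hi
      by_cases hU : T.host i ∈ U
      · by_cases hret : T.host i ∈ net.retained T.toCliqueGraph g U
        · rw [hhost_keep i hi (Or.inr hret)]
          exact ⟨Or.inr (hfit.retained_subset hret), h₂⟩
        · obtain ⟨h₃, h₄⟩ := hhost_move i hi hU hret
          exact ⟨Or.inr h₃, h₄⟩
      · rw [hhost_keep i hi (Or.inl hU)]
        exact ⟨Or.inl ⟨h₁, hU⟩, h₂⟩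
    · rw [hhost_new v hv]
      exact ⟨Or.inr (hfit.family_mem v hv), subset_rfl⟩
  · intro x
    rw [hfac, Finset.prod_union, hT.product, Finset.prod_image fun _ _ _ _ h => Sum.inr_injective h]
    · rfl
    · rw [Finset.disjoint_right]
      intro i hi
      obtain ⟨v, hv, rfl⟩ := Finset.mem_image.1 hi
      exact hnew v hv

end IsReplacement

theorem exists_isReplacement (hT : T.IsValid net ψ Q) (hadd : net.IsAddable T.toCliqueGraph g U)
    (hfit : net.IsFitting T.toCliqueGraph g U ST) : ∃ T', net.IsReplacement ψ T g U ST T' := by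
  classical
  choose! f hf hsub using hfit.exists_subset
  refine ⟨{
    nodes := (T.nodes \ U) ∪ ST.nodes
    graph := SimpleGraph.fromRel (fun A C =>
      (T.graph.Adj A C ∧ A ∉ U ∧ C ∉ U) ∨ ST.graph.Adj A C ∨
        ∃ B ∈ U, A ∉ U ∧ T.graph.Adj A B ∧ C = f B)
    factors := T.factors ∪ g.image Sum.inr
    host := fun i => if i ∈ g.image Sum.inr then (net.factor ψ i).scope
      else if T.host i ∈ U ∧ T.host i ∉ net.retained T.toCliqueGraph g U then f (T.host i)
      else T.host i }, fun _ B => f B, ?_, rfl, rfl, rfl, ?_, ?_, ?_⟩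
  · exact fun A B _ hB _ => ⟨hf B hB, Finset.inter_subset_right.trans (hsub B hB)⟩
  · intro v hv
    exact if_pos (Finset.mem_image_of_mem _ hv)
  all_goals
    intro i hi
    have hig : i ∉ g.image Sum.inr := by
      intro h
      obtain ⟨v, hv, rfl⟩ := Finset.mem_image.1 h
      exact hT.not_mem_factors (hadd.not_mem_vars v hv) hi
    simp only [if_neg hig]
  · intro h
    rw [if_neg]
    rintro ⟨h₁, h₂⟩
    exact h.elim (fun h => h h₁) h₂
  · intro h₁ h₂
    rw [if_pos ⟨h₁, h₂⟩]
    exact ⟨hf _ h₁, (hT.assigned i hi).2.trans (hsub _ h₁)⟩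

end BayesNet

/-! ### Summation over the states of variables -/

section

variable {V : Type*} {D : V → Type*} [DecidableEq V] [∀ v, Fintype (D v)]

theorem sumOut_mul_of_dependsOn {R : Finset V} {s : Set V} {f : ((v : V) → D v) → ℝ}
    (hf : DependsOn f s) (hs : ∀ v ∈ R, v ∉ s) (h : ((v : V) → D v) → ℝ) (x : (v : V) → D v) :
    sumOut R (fun z => f z * h z) x = f x * sumOut R h x := by
  rw [sumOut, sumOut, Finset.mul_sum]
  refine Finset.sum_congr rfl fun y _ => ?_
  congr 1
  refine hf fun v hv => ?_
  rw [Function.updateFinset, dif_neg fun hvR => hs v hvR hv]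

theorem sumOut_insert {R : Finset V} {v : V} (hv : v ∉ R) (f : ((v : V) → D v) → ℝ)
    (x : (v : V) → D v) :
    sumOut (insert v R) f x = sumOut R (fun z => ∑ a : D v, f (Function.update z v a)) x := by
  have hdis : Disjoint R {v} := Finset.disjoint_singleton_right.2 hv
  have hins : insert v R = R ∪ {v} := by rw [Finset.union_comm, Finset.insert_eq]
  rw [hins, sumOut, sumOut, ← (Equiv.piFinsetUnion D hdis).sum_comp, Fintype.sum_prod_type]
  refine Finset.sum_congr rfl fun y _ => ?_
  rw [← (Equiv.piUnique fun i : ({v} : Finset V) => D i).symm.sum_comp]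
  refine Finset.sum_congr rfl fun a _ => ?_
  rw [← Function.updateFinset_updateFinset hdis, Function.updateFinset_singleton]
  rfl

/-- The conditional probability distributions of the variables in `R` sum up to one: sum first over
a variable of `R` without children in `R`. -/
theorem BayesNet.sumOut_prod_cpd [Finite V] (net : BayesNet V D) (R : Finset V)
    (x : (v : V) → D v) : sumOut R (fun z => ∏ v ∈ R, net.cpd v z) x = 1 := by
  induction R using Finset.strongInduction with
  | H R ih =>
    rcases R.eq_empty_or_nonempty with rfl | hR
    · simp [sumOut]
    let r : V → V → Prop := fun a b => Relation.TransGen (fun u w => u ∈ net.parents w) b a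
    have hirr : Std.Irrefl r := ⟨net.acyclic⟩
    have htrans : IsTrans V r := ⟨fun _ _ _ h₁ h₂ => h₂.trans h₁⟩
    have hwf : WellFounded r := Finite.wellFounded_of_trans_of_irrefl r
    obtain ⟨v, hv, hmin⟩ := hwf.has_min (R : Set V) hR
    have hchild : ∀ w ∈ R, v ∉ net.parents w := fun w hw h => hmin w hw (.single h)
    have hnot := Finset.notMem_erase v R
    have hR' : R = insert v (R.erase v) := (Finset.insert_erase hv).symm
    rw [hR', sumOut_insert hnot]
    have hfun : (fun z => ∑ a : D v, ∏ w ∈ insert v (R.erase v), net.cpd w (Function.update z v a))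
        = fun z => ∏ w ∈ R.erase v, net.cpd w z := by
      funext z
      have hconst : ∀ a : D v, ∏ w ∈ R.erase v, net.cpd w (Function.update z v a)
          = ∏ w ∈ R.erase v, net.cpd w z := by
        intro a
        refine Finset.prod_congr rfl fun w hw => net.cpd_dependsOn w fun u hu => ?_
        refine Function.update_of_ne ?_ _ _
        rintro rfl
        rcases Finset.mem_insert.1 (Finset.mem_coe.1 hu) with h | h
        · exact Finset.ne_of_mem_erase hw h.symm
        · exact hchild w (Finset.mem_of_mem_erase hw) h
      simp_rw [Finset.prod_insert hnot, hconst]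
      rw [← Finset.sum_mul, net.cpd_sum, one_mul]
    rw [hfun]
    exact ih _ (Finset.erase_ssubset hv)

end

namespace BayesNet

/-! ### Correctness and termination of the loops -/

section

variable {V : Type*} {D : V → Type*} {J : Type*} [DecidableEq V] [∀ v, Fintype (D v)]
  {net : BayesNet V D} {ψ : J → Factor V D} {T T' : CTF V J} {Q : ((v : V) → D v) → ℝ}

/-- The clique tree forest `T'` is the correct result of the addition of the variables `A` to the
clique tree forest `T` with joint distribution `Q`. -/
structure IsExtension (net : BayesNet V D) (ψ : J → Factor V D) (Q : ((v : V) → D v) → ℝ)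
    (T : CTF V J) (A : Finset V) (T' : CTF V J) : Prop where
  vars_eq : T'.vars = T.vars ∪ A
  isValid : T'.IsValid net ψ fun x => Q x * ∏ v ∈ A, net.cpd v x

theorem IsExtension.refl (hT : T.IsValid net ψ Q) : net.IsExtension ψ Q T ∅ T :=
  ⟨by simp, by simpa using hT⟩

theorem IsExtension.trans {T₁ : CTF V J} {A B : Finset V} (h₁ : net.IsExtension ψ Q T A T₁)
    (h₂ : net.IsExtension ψ (fun x => Q x * ∏ v ∈ A, net.cpd v x) T₁ B T') (hAB : Disjoint A B) :
    net.IsExtension ψ Q T (A ∪ B) T' := by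
  refine ⟨by rw [h₂.vars_eq, h₁.vars_eq, Finset.union_assoc], ?_⟩
  simp_rw [Finset.prod_union hAB, ← mul_assoc]
  exact h₂.isValid

theorem mem_sources {G : Finset V} {v : V} :
    v ∈ net.sources G ↔ v ∈ G ∧ Disjoint (net.parents v) G := by simp [sources]

namespace IsGrouping

variable {F : CliqueGraph V} {R : Finset V} {L : Finset (Finset V)}

theorem subset (h : net.IsGrouping F R L) : ∀ g ∈ L, g ⊆ R := by
  classical
  obtain ⟨m, -, rfl⟩ := h
  intro g hg
  obtain ⟨u, -, rfl⟩ := Finset.mem_image.1 hg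
  exact Finset.filter_subset _ _

theorem nonempty (h : net.IsGrouping F R L) : ∀ g ∈ L, g.Nonempty := by
  classical
  obtain ⟨m, -, rfl⟩ := h
  intro g hg
  obtain ⟨u, hu, rfl⟩ := Finset.mem_image.1 hg
  exact ⟨u, Finset.mem_filter.2 ⟨hu, .refl⟩⟩

theorem pairwiseDisjoint (h : net.IsGrouping F R L) :
    (L : Set (Finset V)).PairwiseDisjoint id := by
  classical
  obtain ⟨m, -, rfl⟩ := h
  intro g hg g' hg' hne
  obtain ⟨u, hu, rfl⟩ := Finset.mem_image.1 hg
  obtain ⟨u', hu', rfl⟩ := Finset.mem_image.1 hg'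
  have hsymm : Std.Symm (fun a b => a ∈ R ∧ b ∈ R ∧ ¬ Disjoint (m a) (m b)) :=
    ⟨fun a b h => ⟨h.2.1, h.1, fun h' => h.2.2 h'.symm⟩⟩
  refine Finset.disjoint_left.2 fun w hw hw' => hne ?_
  have h₁ := (Finset.mem_filter.1 hw).2
  have h₂ := (Finset.mem_filter.1 hw').2
  have h₃ := h₁.trans (Std.Symm.symm _ _ h₂)
  refine Finset.filter_congr fun z _ => ⟨fun h => ?_, fun h => h₃.trans h⟩
  exact (Std.Symm.symm _ _ h₃).trans h

theorem exists_grouping (net : BayesNet V D) (F : CliqueGraph V) (R : Finset V) :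
    ∃ L, net.IsGrouping F R L := by
  choose m hm using fun v => F.exists_isMSG (net.parents v)
  exact ⟨_, m, fun v _ => hm v, rfl⟩

theorem empty (net : BayesNet V D) (F : CliqueGraph V) : net.IsGrouping F ∅ ∅ :=
  ⟨fun _ => ∅, by simp, by simp⟩

end IsGrouping

end

section

variable {V : Type*} {D : V → Type*} {J : Type*} [DecidableEq V] [DecidableEq J]
  [∀ v, Fintype (D v)] {net : BayesNet V D} {ψ : J → Factor V D} {T T' : CTF V J}
  {Q : ((v : V) → D v) → ℝ}

namespace SimpleLoop

variable {N R : Finset V}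

theorem remaining_subset (h : net.SimpleLoop N T T' R) : R ⊆ N := by
  induction h with
  | done => exact subset_rfl
  | add v U hv _ _ _ ih => exact ih.trans (Finset.erase_subset _ _)
  | skip v U hv _ _ _ ih => exact Finset.insert_subset hv (ih.trans (Finset.erase_subset _ _))

/-- A variable without parents has an empty minimal subgraph, so it is added in the first loop. -/
theorem parents_nonempty (h : net.SimpleLoop N T T' R) : ∀ v ∈ R, (net.parents v).Nonempty := by
  induction h with
  | done => simp
  | add v U hv _ _ _ ih => exact ih
  | skip v U hv hU hcase _ ih =>
    intro w hw
    rcases Finset.mem_insert.1 hw with rfl | hw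
    · rw [Finset.nonempty_iff_ne_empty]
      intro hempty
      rw [hempty] at hU
      rw [hU.eq_empty] at hcase
      exact hcase fun A hA => by simp at hA
    · exact ih w hw

theorem isExtension (h : net.SimpleLoop N T T' R) (hT : T.IsValid net ψ Q)
    (hN : ∀ v ∈ N, v ∉ T.vars) (hpar : ∀ v ∈ N, net.parents v ⊆ T.vars) :
    net.IsExtension ψ Q T (N \ R) T' := by
  induction h generalizing Q with
  | done T => simpa using IsExtension.refl hT
  | @add N R T T' v U hv hU hcase h ih =>
    have hvars := vars_addSimple (U := U) (hpar v hv)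
    have hstep : net.IsExtension ψ Q T {v} (net.addSimple T U v) := by
      refine ⟨by rw [hvars, Finset.union_comm, Finset.insert_eq], ?_⟩
      simpa using isValid_addSimple hT (hN v hv) (hpar v hv) hU hcase
    have hrest := ih hstep.isValid (fun w hw => by
        rw [hvars, Finset.mem_insert, not_or]
        exact ⟨Finset.ne_of_mem_erase hw, hN w (Finset.mem_of_mem_erase hw)⟩)
      (fun w hw => by
        rw [hvars]
        exact (hpar w (Finset.mem_of_mem_erase hw)).trans (Finset.subset_insert _ _))
    have hset : N \ R = {v} ∪ (N.erase v \ R) := by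
      have hvR : v ∉ R := fun hvR => Finset.notMem_erase v N (h.remaining_subset hvR)
      ext w
      simp only [Finset.mem_sdiff, Finset.mem_union, Finset.mem_singleton, Finset.mem_erase]
      grind
    rw [hset]
    exact hstep.trans hrest (by simp)
  | @skip N R T T' v U hv hU hcase h ih =>
    have hset : N \ insert v R = N.erase v \ R := by
      ext w
      simp only [Finset.mem_sdiff, Finset.mem_insert, Finset.mem_erase]
      tauto
    rw [hset]
    exact ih hT (fun w hw => hN w (Finset.mem_of_mem_erase hw))
      fun w hw => hpar w (Finset.mem_of_mem_erase hw)

theorem exists_run (net : BayesNet V D) (N : Finset V) :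
    ∀ T : CTF V J, ∃ T' R, net.SimpleLoop N T T' R := by
  induction N using Finset.induction_on with
  | empty => exact fun T => ⟨T, ∅, .done T⟩
  | insert v N hv ih =>
    intro T
    obtain ⟨U, hU⟩ := T.toCliqueGraph.exists_isMSG (net.parents v)
    by_cases hcase : T.Disconnected U
    · obtain ⟨T', R, h⟩ := ih (net.addSimple T U v)
      refine ⟨T', R, .add v U (Finset.mem_insert_self _ _) hU hcase ?_⟩
      rwa [Finset.erase_insert hv]
    · obtain ⟨T', R, h⟩ := ih T
      refine ⟨T', insert v R, .skip v U (Finset.mem_insert_self _ _) hU hcase ?_⟩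
      rwa [Finset.erase_insert hv]

end SimpleLoop

end

variable {V : Type*} {D : V → Type*} {J : Type*} [Fintype V] [DecidableEq V] [DecidableEq J]
  [∀ v, Fintype (D v)] {net : BayesNet V D} {ψ : J → Factor V D} {mcs : ℝ}
  {T T' : CTF V J} {Q : ((v : V) → D v) → ℝ}

namespace GroupLoop

variable {E Na : Finset V} {L : Finset (Finset V)}

theorem isExtension (h : net.GroupLoop ψ mcs E L T T' Na) (hT : T.IsValid net ψ Q)
    (hL : (L : Set (Finset V)).PairwiseDisjoint id) (hnew : ∀ g ∈ L, ∀ v ∈ g, v ∉ T.vars)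
    (hpar : ∀ g ∈ L, ∀ v ∈ g, net.parents v ⊆ T.vars) :
    net.IsExtension ψ Q T Na T' ∧ ∀ v ∈ Na, ∃ g ∈ L, v ∈ g := by
  induction h generalizing Q with
  | done T => exact ⟨IsExtension.refl hT, by simp⟩
  | @add L T T₁ T' Na g U ST hg hU hST hsize hT₁ h ih =>
    have hadd := hU.isAddable hT.isCliqueForest.toIsForest (hnew g hg) (hpar g hg)
    have hfit := hadd.isFitting hT.isCliqueForest hST
    have hstep : net.IsExtension ψ Q T g T₁ := ⟨hT₁.vars_eq hadd hfit, hT₁.isValid hT hadd hfit⟩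
    have hdis : ∀ g' ∈ L.erase g, ∀ v ∈ g', v ∉ g := fun g' hg' v hv hvg =>
      Finset.disjoint_left.1 (hL (Finset.mem_of_mem_erase hg') hg (Finset.ne_of_mem_erase hg'))
        hv hvg
    obtain ⟨hrest, hNa⟩ := ih hstep.isValid
      (hL.subset (Finset.coe_subset.2 (Finset.erase_subset _ _)))
      (fun g' hg' v hv => by
        rw [hstep.vars_eq, Finset.mem_union, not_or]
        exact ⟨hnew g' (Finset.mem_of_mem_erase hg') v hv, hdis g' hg' v hv⟩)
      (fun g' hg' v hv => by
        rw [hstep.vars_eq]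
        exact (hpar g' (Finset.mem_of_mem_erase hg') v hv).trans Finset.subset_union_left)
    refine ⟨hstep.trans hrest (Finset.disjoint_right.2 fun v hv => ?_), fun v hv => ?_⟩
    · obtain ⟨g', hg', hv⟩ := hNa v hv
      exact hdis g' hg' v hv
    · rcases Finset.mem_union.1 hv with hv | hv
      · exact ⟨g, hg, hv⟩
      · obtain ⟨g', hg', hv⟩ := hNa v hv
        exact ⟨g', Finset.mem_of_mem_erase hg', hv⟩
  | @split L L' T T' Na g Ns U ST hg hU hST hsize hNs hprio hL' h ih =>
    have hold : ∀ g' ∈ L.erase g ∪ L', ∃ g'' ∈ L, g' ⊆ g'' := by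
      intro g' hg'
      rcases Finset.mem_union.1 hg' with hg' | hg'
      · exact ⟨g', Finset.mem_of_mem_erase hg', subset_rfl⟩
      · exact ⟨g, hg, (hL'.subset g' hg').trans hNs.subset⟩
    have hmix : ∀ g₁ ∈ L.erase g, ∀ g₂ ∈ L', Disjoint g₁ g₂ := fun g₁ h₁ g₂ h₂ =>
      Disjoint.mono_right ((hL'.subset g₂ h₂).trans hNs.subset)
        (hL (Finset.mem_of_mem_erase h₁) hg (Finset.ne_of_mem_erase h₁))
    obtain ⟨hext, hNa⟩ := ih hT
      (by
        intro g₁ h₁ g₂ h₂ hne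
        rcases Finset.mem_union.1 h₁ with h₁ | h₁ <;> rcases Finset.mem_union.1 h₂ with h₂ | h₂
        · exact hL (Finset.mem_of_mem_erase h₁) (Finset.mem_of_mem_erase h₂) hne
        · exact hmix g₁ h₁ g₂ h₂
        · exact (hmix g₂ h₂ g₁ h₁).symm
        · exact hL'.pairwiseDisjoint h₁ h₂ hne)
      (fun g' hg' v hv => by
        obtain ⟨g'', hg'', hsub⟩ := hold g' hg'
        exact hnew g'' hg'' v (hsub hv))
      (fun g' hg' v hv => by
        obtain ⟨g'', hg'', hsub⟩ := hold g' hg'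
        exact hpar g'' hg'' v (hsub hv))
    refine ⟨hext, fun v hv => ?_⟩
    obtain ⟨g', hg', hv⟩ := hNa v hv
    obtain ⟨g'', hg'', hsub⟩ := hold g' hg'
    exact ⟨g'', hg'', hsub hv⟩

/-- The loop can be carried out: a group that does not respect the clique size bound may be split
into its empty subset. -/
theorem exists_run (net : BayesNet V D) (ψ : J → Factor V D) (mcs : ℝ) (E : Finset V)
    (L : Finset (Finset V)) : ∀ (T : CTF V J) (Q : ((v : V) → D v) → ℝ), T.IsValid net ψ Q →
      (L : Set (Finset V)).PairwiseDisjoint id → (∀ g ∈ L, ∀ v ∈ g, v ∉ T.vars) →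
      (∀ g ∈ L, ∀ v ∈ g, net.parents v ⊆ T.vars) →
      (∀ g ∈ L, ∃ v ∈ g, (net.parents v).Nonempty) →
      ∃ T' Na, net.GroupLoop ψ mcs E L T T' Na := by
  induction L using Finset.induction_on with
  | empty => exact fun T _ _ _ _ _ _ => ⟨T, ∅, .done T⟩
  | insert g L hgL ih =>
    intro T Q hT hL hnew hpar hne
    have hg := Finset.mem_insert_self g L
    have hmem : ∀ g' ∈ L, g' ∈ insert g L := fun g' => Finset.mem_insert_of_mem
    have hL' : (L : Set (Finset V)).PairwiseDisjoint id :=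
      hL.subset (Finset.coe_subset.2 (Finset.subset_insert g L))
    choose m hm using fun v => T.toCliqueGraph.exists_isMSG (net.parents v)
    have hU : net.IsGroupMSG T.toCliqueGraph g (T.hull (g.biUnion m)) := ⟨m, fun v _ => hm v, rfl⟩
    obtain ⟨ST, hST⟩ := exists_isModifiedSubtree net T.toCliqueGraph (T.hull (g.biUnion m))
      (hne g hg)
    by_cases hsize : ∀ C ∈ ST.nodes, cliqueSize D C ≤ mcs
    · have hadd := hU.isAddable hT.isCliqueForest.toIsForest (hnew g hg) (hpar g hg)
      have hfit := hadd.isFitting hT.isCliqueForest hST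
      obtain ⟨T₁, hT₁⟩ := exists_isReplacement hT hadd hfit
      have hvars := hT₁.vars_eq hadd hfit
      obtain ⟨T', Na, h⟩ := ih T₁ _ (hT₁.isValid hT hadd hfit) hL'
        (fun g' hg' v hv => by
          rw [hvars, Finset.mem_union, not_or]
          refine ⟨hnew g' (hmem g' hg') v hv, fun hvg => ?_⟩
          exact Finset.disjoint_left.1 (hL (hmem g' hg') hg fun h => hgL (h ▸ hg')) hv hvg)
        (fun g' hg' v hv => by
          rw [hvars]
          exact (hpar g' (hmem g' hg') v hv).trans Finset.subset_union_left)
        (fun g' hg' => hne g' (hmem g' hg'))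
      refine ⟨T', g ∪ Na, .add g _ ST hg hU hST hsize hT₁ ?_⟩
      rwa [Finset.erase_insert hgL]
    · push Not at hsize
      obtain ⟨T', Na, h⟩ := ih T Q hT hL' (fun g' hg' => hnew g' (hmem g' hg'))
        (fun g' hg' => hpar g' (hmem g' hg')) (fun g' hg' => hne g' (hmem g' hg'))
      have hgne : g.Nonempty := (hne g hg).imp fun _ h => h.1
      refine ⟨T', Na, .split g ∅ _ ST hg hU hST hsize (Finset.empty_ssubset.2 hgne) (by simp)
        (.empty net _) ?_⟩
      rwa [Finset.erase_insert hgL, Finset.union_empty]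

end GroupLoop

namespace ModifyCTF

variable {N E Na : Finset V}

theorem isExtension (h : net.ModifyCTF ψ mcs T N E T' Na) (hT : T.IsValid net ψ Q)
    (hN : ∀ v ∈ N, v ∉ T.vars) (hpar : ∀ v ∈ N, net.parents v ⊆ T.vars) :
    net.IsExtension ψ Q T Na T' ∧ Na ⊆ N := by
  obtain ⟨T₁, R, L, Ng, hsimple, hgroup, hloop, rfl⟩ := h
  have h₁ := hsimple.isExtension hT hN hpar
  have hRN := hsimple.remaining_subset
  obtain ⟨h₂, hNg⟩ := hloop.isExtension h₁.isValid hgroup.pairwiseDisjoint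
    (fun g hg v hv => by
      have hvR := hgroup.subset g hg hv
      rw [h₁.vars_eq]
      simp [hN v (hRN hvR), hvR])
    (fun g hg v hv => by
      rw [h₁.vars_eq]
      exact (hpar v (hRN (hgroup.subset g hg hv))).trans Finset.subset_union_left)
  have hNgR : Ng ⊆ R := fun v hv => by
    obtain ⟨g, hg, hv⟩ := hNg v hv
    exact hgroup.subset g hg hv
  exact ⟨h₁.trans h₂ (Finset.disjoint_of_subset_right hNgR Finset.sdiff_disjoint),
    Finset.union_subset Finset.sdiff_subset (hNgR.trans hRN)⟩

theorem exists_run (mcs : ℝ) (E : Finset V) (hT : T.IsValid net ψ Q) (hN : ∀ v ∈ N, v ∉ T.vars)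
    (hpar : ∀ v ∈ N, net.parents v ⊆ T.vars) :
    ∃ T' Na, net.ModifyCTF ψ mcs T N E T' Na := by
  obtain ⟨T₁, R, hsimple⟩ := SimpleLoop.exists_run net N T
  obtain ⟨L, hgroup⟩ := IsGrouping.exists_grouping net T₁.toCliqueGraph R
  have h₁ := hsimple.isExtension hT hN hpar
  have hRN := hsimple.remaining_subset
  obtain ⟨T', Ng, hloop⟩ := GroupLoop.exists_run net ψ mcs E L T₁ _ h₁.isValid
    hgroup.pairwiseDisjoint
    (fun g hg v hv => by
      have hvR := hgroup.subset g hg hv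
      rw [h₁.vars_eq]
      simp [hN v (hRN hvR), hvR])
    (fun g hg v hv => by
      rw [h₁.vars_eq]
      exact (hpar v (hRN (hgroup.subset g hg hv))).trans Finset.subset_union_left)
    (fun g hg => by
      obtain ⟨v, hv⟩ := hgroup.nonempty g hg
      exact ⟨v, hv, hsimple.parents_nonempty v (hgroup.subset g hg hv)⟩)
  exact ⟨T', _, T₁, R, L, Ng, hsimple, hgroup, hloop, rfl⟩

end ModifyCTF

end BayesNet

/-! ### The main loop -/

namespace BayesNet

section

variable {V : Type*} {D : V → Type*} [Fintype V] [DecidableEq V] [∀ v, Fintype (D v)]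
  {net : BayesNet V D}

theorem lowest_subset (net : BayesNet V D) (N : Finset V) : net.lowest N ⊆ N :=
  Finset.filter_subset _ _

theorem lowest_nonempty (net : BayesNet V D) {N : Finset V} (hN : N.Nonempty) :
    (net.lowest N).Nonempty := by
  obtain ⟨v, hv, h⟩ := N.exists_min_image net.level hN
  exact ⟨v, Finset.mem_filter.2 ⟨hv, h⟩⟩

/-- The invariant of the main loop of `BuildCTF`, where `W` is the set of the variables already in
the clique tree forest, `G` the set of those still to be added, and `Nact` the set of active
variables. -/
structure LoopInvariant (net : BayesNet V D) (W G Nact : Finset V) : Prop where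
  disjoint : Disjoint G W
  parents_subset : ∀ v ∈ G, net.parents v ⊆ W ∪ G
  active_subset : Nact ⊆ net.sources G

namespace LoopInvariant

variable {W G Nact Na : Finset V}

theorem lowest_subset (h : net.LoopInvariant W G Nact) : net.lowest Nact ⊆ G := fun _ hv =>
  (mem_sources.1 (h.active_subset (net.lowest_subset _ hv))).1

theorem not_mem (h : net.LoopInvariant W G Nact) : ∀ v ∈ net.lowest Nact, v ∉ W := fun _ hv =>
  Finset.disjoint_left.1 h.disjoint (h.lowest_subset hv)

/-- An active variable has all its parents in the clique tree forest already. -/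
theorem parents_lowest (h : net.LoopInvariant W G Nact) :
    ∀ v ∈ net.lowest Nact, net.parents v ⊆ W := by
  intro v hv x hx
  obtain ⟨hvG, hdis⟩ := mem_sources.1 (h.active_subset (net.lowest_subset _ hv))
  exact (Finset.mem_union.1 (h.parents_subset v hvG hx)).resolve_right
    (Finset.disjoint_left.1 hdis hx)

theorem step (h : net.LoopInvariant W G Nact) (hNa : Na ⊆ net.lowest Nact) (P : V → Prop)
    [DecidablePred P] : net.LoopInvariant (W ∪ Na) (G \ Na)
      ((Nact \ net.lowest Nact) ∪ (net.sources (G \ Na)).filter P) := by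
  refine ⟨?_, ?_, ?_⟩
  · rw [Finset.disjoint_union_right]
    exact ⟨Finset.disjoint_of_subset_left Finset.sdiff_subset h.disjoint, Finset.sdiff_disjoint⟩
  · intro v hv x hx
    have := h.parents_subset v (Finset.mem_sdiff.1 hv).1 hx
    simp only [Finset.mem_union, Finset.mem_sdiff] at this ⊢
    tauto
  · refine Finset.union_subset (fun v hv => ?_) (Finset.filter_subset _ _)
    obtain ⟨hv, hvl⟩ := Finset.mem_sdiff.1 hv
    obtain ⟨hvG, hdis⟩ := mem_sources.1 (h.active_subset hv)
    exact mem_sources.2 ⟨Finset.mem_sdiff.2 ⟨hvG, fun h => hvl (hNa h)⟩,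
      Finset.disjoint_of_subset_right Finset.sdiff_subset hdis⟩

end LoopInvariant

end

section

variable {V : Type*} {D : V → Type*} {J : Type*} [DecidableEq V] [∀ v, Fintype (D v)]
  {net : BayesNet V D} {ψ : J → Factor V D} {T T' : CTF V J} {Q : ((v : V) → D v) → ℝ}

/-- The disjoint cliques that the algorithm starts from extend an empty clique tree forest. -/
theorem isExtension_initialCTF [DecidableEq J] (hT : T.IsValid net ψ Q) (hempty : T.nodes = ∅)
    {P : Finset V} (hP : ∀ v ∈ P, net.parents v = ∅) : net.IsExtension ψ Q T P (initialCTF J P) := by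
  have hmem : ∀ C, C ∈ (initialCTF J P).nodes ↔ ∃ v ∈ P, {v} = C := by simp [initialCTF]
  have hforest : (initialCTF J P).toCliqueGraph.IsForest := by
    refine .of_walks (fun A B h => (h : (⊥ : SimpleGraph (Finset V)).Adj A B).elim)
      SimpleGraph.isAcyclic_bot fun x A hA B hB hxA hxB => ?_
    obtain ⟨v, -, rfl⟩ := (hmem A).1 hA
    obtain ⟨w, -, rfl⟩ := (hmem B).1 hB
    obtain rfl := Finset.mem_singleton.1 hxA
    obtain rfl := Finset.mem_singleton.1 hxB
    exact ⟨.nil, by simp⟩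
  refine ⟨?_, hforest.edge_mem, hforest.acyclic, ?_, ?_, hforest.running, ?_, ?_⟩
  · ext x
    simp [CliqueGraph.mem_vars, hmem, hempty]
  · intro C hC
    obtain ⟨v, -, rfl⟩ := (hmem C).1 hC
    exact Finset.singleton_nonempty v
  · intro A hA B hB hAB
    obtain ⟨v, -, rfl⟩ := (hmem A).1 hA
    obtain ⟨w, -, rfl⟩ := (hmem B).1 hB
    rw [Finset.singleton_subset_singleton.1 hAB]
  · intro i hi
    obtain ⟨v, hv, rfl⟩ := Finset.mem_image.1 hi
    refine ⟨(hmem _).2 ⟨v, hv, rfl⟩, fun x hx => ?_⟩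
    rcases mem_family.1 hx with rfl | hx
    · exact Finset.mem_singleton_self x
    · simp [hP v hv] at hx
  · intro x
    have hfac : T.factors = ∅ := by
      refine Finset.eq_empty_of_forall_notMem fun i hi => ?_
      simpa [hempty] using (hT.assigned i hi).1
    rw [← hT.product, hfac, Finset.prod_empty, one_mul]
    simp only [initialCTF]
    rw [Finset.prod_image fun _ _ _ _ h => Sum.inr_injective h]
    rfl

/-- The distributions of the variables that have not been added sum up to one, so that the product
of the assigned factors is the marginal. -/
theorem IsExtension.isValid_sumOut [Finite V] {G G' : Finset V}
    (h : net.IsExtension ψ Q T (G \ G') T')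
    (hG : Disjoint G T.vars) (hG' : G' ⊆ G) :
    T'.IsValid net ψ (sumOut G' fun x => Q x * ∏ v ∈ G, net.cpd v x) := by
  have hsum : (sumOut G' fun x => Q x * ∏ v ∈ G, net.cpd v x)
      = fun x => Q x * ∏ v ∈ G \ G', net.cpd v x := by
    funext x
    simp_rw [← Finset.prod_sdiff hG', ← mul_assoc]
    rw [sumOut_mul_of_dependsOn h.isValid.dependsOn _ (fun z => ∏ v ∈ G', net.cpd v z),
      net.sumOut_prod_cpd, mul_one]
    intro v hv hvT
    rw [Finset.mem_coe, h.vars_eq, Finset.mem_union] at hvT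
    rcases hvT with hvT | hvT
    · exact Finset.disjoint_left.1 hG (hG' hv) hvT
    · exact (Finset.mem_sdiff.1 hvT).2 hv
  rw [hsum]
  exact h.isValid

end

variable {V : Type*} {D : V → Type*} {J : Type*} [Fintype V] [DecidableEq V] [DecidableEq J]
  [∀ v, Fintype (D v)] {net : BayesNet V D} {ψ : J → Factor V D} {mcs : ℝ}
  {T T' : CTF V J} {Q : ((v : V) → D v) → ℝ}

namespace BuildLoop

theorem isExtension {IV E Nact IV' G' E' : Finset V}
    (h : net.BuildLoop ψ mcs T IV G E Nact T' IV' G' E') (hT : T.IsValid net ψ Q)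
    (hinv : net.LoopInvariant T.vars G Nact) : G' ⊆ G ∧ net.IsExtension ψ Q T (G \ G') T' := by
  induction h generalizing Q with
  | done T IV G E => exact ⟨subset_rfl, by simpa using IsExtension.refl hT⟩
  | @step T T₁ T' IV G E Nact Na IV' G' E' hact hmod h ih =>
    obtain ⟨h₁, hNa⟩ := hmod.isExtension hT hinv.not_mem hinv.parents_lowest
    obtain ⟨hG', h₂⟩ := ih h₁.isValid (h₁.vars_eq ▸ hinv.step hNa fun w => ∃ u ∈ Na, u ∈ net.parents w)
    have hNaG := hNa.trans hinv.lowest_subset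
    have hset : G \ G' = Na ∪ ((G \ Na) \ G') := by
      ext v
      have h₁ := @hNaG v
      have h₂ := @hG' v
      simp only [Finset.mem_union, Finset.mem_sdiff] at h₂ ⊢
      tauto
    refine ⟨hG'.trans Finset.sdiff_subset, ?_⟩
    rw [hset]
    exact h₁.trans h₂ (Finset.disjoint_of_subset_right Finset.sdiff_subset Finset.disjoint_sdiff)

/-- In every step of the loop, variables are removed from `G`, or else `G` stays the same and active
variables are removed without replacement. -/
theorem exists_run (net : BayesNet V D) (ψ : J → Factor V D) (mcs : ℝ) (G : Finset V) :
    ∀ (Nact IV E : Finset V) (T : CTF V J) (Q : ((v : V) → D v) → ℝ), T.IsValid net ψ Q →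
      net.LoopInvariant T.vars G Nact →
      ∃ T' IV' G' E', net.BuildLoop ψ mcs T IV G E Nact T' IV' G' E' := by
  induction G using Finset.strongInduction with
  | H G ihG =>
    intro Nact
    induction Nact using Finset.strongInduction with
    | H Nact ihN =>
      intro IV E T Q hT hinv
      rcases Nact.eq_empty_or_nonempty with rfl | hact
      · exact ⟨T, IV, G, E, .done T IV G E⟩
      obtain ⟨T₁, Na, hmod⟩ := ModifyCTF.exists_run mcs E hT hinv.not_mem hinv.parents_lowest
      obtain ⟨h₁, hNa⟩ := hmod.isExtension hT hinv.not_mem hinv.parents_lowest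
      have hinv₁ : net.LoopInvariant T₁.vars (G \ Na) ((Nact \ net.lowest Nact) ∪
          (net.sources (G \ Na)).filter fun w => ∃ u ∈ Na, u ∈ net.parents w) :=
        h₁.vars_eq ▸ hinv.step hNa fun w => ∃ u ∈ Na, u ∈ net.parents w
      suffices h : ∃ T' IV' G' E', net.BuildLoop ψ mcs T₁
          (IV ∪ (net.lowest Nact \ Na).biUnion net.parents) (G \ Na) (E \ Na)
          ((Nact \ net.lowest Nact) ∪
            (net.sources (G \ Na)).filter fun w => ∃ u ∈ Na, u ∈ net.parents w)
          T' IV' G' E' by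
        obtain ⟨T', IV', G', E', h⟩ := h
        exact ⟨T', IV', G', E', .step hact hmod h⟩
      rcases Na.eq_empty_or_nonempty with rfl | hne
      · have hempty : ((net.sources (G \ ∅)).filter
            fun w => ∃ u ∈ (∅ : Finset V), u ∈ net.parents w) = ∅ := by simp
        rw [hempty, Finset.union_empty] at hinv₁ ⊢
        simp only [Finset.sdiff_empty] at hinv₁ ⊢
        exact ihN _ (Finset.sdiff_ssubset (net.lowest_subset Nact) (net.lowest_nonempty hact))
          _ _ _ _ h₁.isValid hinv₁
      · exact ihG _ (Finset.sdiff_ssubset (hNa.trans hinv.lowest_subset) hne) _ _ _ _ _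
          h₁.isValid hinv₁

end BuildLoop

end BayesNet

theorem theorem1 {V : Type*} {D : V → Type*} {J : Type*}
    [Fintype V] [DecidableEq V] [DecidableEq J]
    [∀ v, Fintype (D v)] [∀ v, Nonempty (D v)]
    (net : BayesNet V D) (ψ : J → Factor V D) (mcs : ℝ)
    (T : CTF V J) (G E : Finset V) (Q : ((v : V) → D v) → ℝ)
    (hT : T.IsValid net ψ Q)
    (hG : Disjoint G T.vars)
    (hparents : ∀ v ∈ G, net.parents v ⊆ T.vars ∪ G) :
    (∃ (T' : CTF V J) (IV G' E' : Finset V), net.BuildCTF ψ mcs T G E T' IV G' E') ∧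
    ∀ (T' : CTF V J) (IV G' E' : Finset V), net.BuildCTF ψ mcs T G E T' IV G' E' →
      G' ⊆ G ∧ T'.vars = T.vars ∪ (G \ G') ∧
      T'.IsValid net ψ (sumOut G' fun x => Q x * ∏ v ∈ G, net.cpd v x) := by
  have hinv : net.LoopInvariant T.vars G (net.sources G) := ⟨hG, hparents, subset_rfl⟩
  have hsub : net.sources G ⊆ G := Finset.filter_subset _ _
  -- the state after the start from an empty clique tree forest
  have hstart : T.nodes = ∅ →
      net.IsExtension ψ Q T (net.sources G) (BayesNet.initialCTF J (net.sources G)) ∧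
      net.LoopInvariant (BayesNet.initialCTF J (net.sources G)).vars (G \ net.sources G)
        (net.sources (G \ net.sources G)) := by
    intro hempty
    have hvars : T.vars = ∅ := by simp [CliqueGraph.vars, hempty]
    have hext := BayesNet.isExtension_initialCTF (P := net.sources G) hT hempty fun v hv => by
      obtain ⟨hvG, hdis⟩ := BayesNet.mem_sources.1 hv
      have := hparents v hvG
      rw [hvars, Finset.empty_union] at this
      exact Finset.disjoint_self_iff_empty _ |>.1 (Finset.disjoint_of_subset_right this hdis)
    refine ⟨hext, ?_, ?_, subset_rfl⟩
    · rw [hext.vars_eq, hvars, Finset.empty_union]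
      exact Finset.sdiff_disjoint
    · intro v hv
      rw [hext.vars_eq, hvars, Finset.empty_union, Finset.union_sdiff_of_subset hsub]
      simpa [hvars] using hparents v (Finset.mem_sdiff.1 hv).1
  constructor
  · by_cases hempty : T.nodes = ∅
    · obtain ⟨hext, hinv'⟩ := hstart hempty
      obtain ⟨T', IV, G', E', h⟩ := BayesNet.BuildLoop.exists_run net ψ mcs _ _ ∅ (E \ net.sources G) _ _
        hext.isValid hinv'
      exact ⟨T', IV, G', E', Or.inl ⟨hempty, h⟩⟩
    · obtain ⟨T', IV, G', E', h⟩ := BayesNet.BuildLoop.exists_run net ψ mcs _ _ ∅ E _ _ hT hinv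
      exact ⟨T', IV, G', E', Or.inr ⟨hempty, h⟩⟩
  · intro T' IV G' E' h
    suffices hmain : G' ⊆ G ∧ net.IsExtension ψ Q T (G \ G') T' from
      ⟨hmain.1, hmain.2.vars_eq, hmain.2.isValid_sumOut hG hmain.1⟩
    rcases h with ⟨hempty, h⟩ | ⟨-, h⟩
    · obtain ⟨hext, hinv'⟩ := hstart hempty
      obtain ⟨hG', h₂⟩ := h.isExtension hext.isValid hinv'
      have hset : G \ G' = net.sources G ∪ ((G \ net.sources G) \ G') := by
        ext v
        have h₁ := @hsub v
        have h₂ := @hG' v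
        simp only [Finset.mem_union, Finset.mem_sdiff] at h₂ ⊢
        tauto
      refine ⟨hG'.trans Finset.sdiff_subset, ?_⟩
      rw [hset]
      exact hext.trans h₂
        (Finset.disjoint_of_subset_right Finset.sdiff_subset Finset.disjoint_sdiff)
    · exact h.isExtension hT hinv
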